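/- **Proposition 6.1.** Set $c=m=1$. For $p,q\in\mathbb R^3$ and $\omega\in\mathbb S^2$ write $p^0=\sqrt{1+|p|^2}$, $p^\mu=(p^0,p)$, $a^\mu b_\mu=-a^0b^0+\sum_{i=1}^3 a^ib^i$, $$s=-(p^\mu+q^\mu)(p_\mu+q_\mu),\qquad g=\sqrt{(p^\mu-q^\mu)(p_\mu-q_\mu)},\qquad v_{\mathrm M}=\frac{g\sqrt s}{p^0q^0},\qquad \gamma=\frac{p^0+q^0}{\sqrt s},$$ $$p'=\frac{p+q}{2}+\frac g2\Big(\omega+(\gamma-1)(p+q)\frac{(p+q)\cdot\omega}{|p+q|^2}\Big),\qquad q'=\frac{p+q}{2}-\frac g2\Big(\omega+(\gamma-1)(p+q)\frac{(p+q)\cdot\omega}{|p+q|^2}\Big),$$ and let $\theta\in[0,\pi]$ be the scattering angle, $\cos\theta=(p^\mu-q^\mu)(p'_\mu-q'_\mu)/g^2$. Let the scattering kernel $\sigma$ satisfy $\sigma(g,\theta)\approx g\,\sigma_0(\theta)$, that is, $$c_1\,g\,\sigma_0(\theta)\le\sigma(g,\theta)\le c_2\,g\,\sigma_0(\theta)\qquad(g>0,\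 \theta\in[0,\pi])$$ with constants $c_1,c_2>0$, where $\sigma$, $\sigma_0$ are measurable and $0\le\sigma_0\le M$ on $[0,\pi]$ for a constant $M>0$. Let $$Q^+(f,f)(x_1,p)=\int_{\mathbb R^3}\int_{\mathbb S^2}v_{\mathrm M}\,\sigma(g,\theta)\,f(x_1,p')\,f(x_1,q')\,d\omega\,dq$$ be the gain term of the relativistic collision operator. For $k>0$ let $\varphi(p)=e^{kp^0}$, and put $$\|f(\cdot,p)\|_{L^\infty_{x_1}}=\operatorname*{ess\,sup}_{x_1\in[0,1]}|f(x_1,p)|,\qquad \|f\|=\int_{\mathbb R^3}(p^0)^{1/2}\varphi(p)\,\|f(\cdot,p)\|_{L^\infty_{x_1}}\,dp .$$ There is a constant $C>0$, depending only on $M,c_1,c_2$, such that for every such kernel, every $k>0$ and every measurable $f:[0,1]\times\mathbb R^3\to\mathbb R$ with $\|f\|<\infty$ the following holds. For every two-dimensional plane $E\subset\mathbb R^3$ through the origin, the integral defining $Q^+(f,f)(x_1,p)$ converges absolutely for almost every $p\in E$ (with respect to the two-dimensional Lebesgue measure $\sigma_E$ on $E$) and almost every $x_1\in[0,1]$, and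 $$\sup_E\int_E(p^0)^{1/2}\varphi(p)\,\|Q^+(f,f)(\cdot,p)\|_{L^\infty_{x_1}}\,d\sigma_E(p)\le C\,\|f\|^2,$$ where the supremum is over all two-dimensional planes $E\subset\mathbb R^3$ through the origin. -/

import Mathlib

open MeasureTheory

namespace RelBoltzmann

noncomputable section

/-- Momentum space `ℝ³` with its Euclidean structure. -/
abbrev Momentum : Type := EuclideanSpace ℝ (Fin 3)

/-- The unit sphere `𝕊²` in momentum space. -/
abbrev Sphere2 : Type := Metric.sphere (0 : Momentum) 1

/-- The surface measure `dω` on `𝕊²` (of total mass `4π`). -/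
def sphereMeasure : Measure Sphere2 := (volume : Measure Momentum).toSphere

/-- The energy `p⁰ = √(1 + |p|²)`, with `c = m = 1`. -/
def energy (p : Momentum) : ℝ := Real.sqrt (1 + ‖p‖ ^ 2)

/-- The energy--momentum four-vector `(p⁰, p)`. -/
def fourVec (p : Momentum) : ℝ × Momentum := (energy p, p)

/-- The Lorentz inner product `a^μ b_μ` of signature `(-,+,+,+)`. -/
def lorentzInner (a b : ℝ × Momentum) : ℝ := -(a.1 * b.1) + inner ℝ a.2 b.2

/-- `s = -(p^μ + q^μ)(p_μ + q_μ)`. -/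
def sInv (p q : Momentum) : ℝ :=
  -lorentzInner (fourVec p + fourVec q) (fourVec p + fourVec q)

/-- The relative momentum `g = √((p^μ - q^μ)(p_μ - q_μ))`. -/
def relMom (p q : Momentum) : ℝ :=
  Real.sqrt (lorentzInner (fourVec p - fourVec q) (fourVec p - fourVec q))

/-- The Møller velocity `g √s / (p⁰ q⁰)`. -/
def mollerVel (p q : Momentum) : ℝ :=
  relMom p q * Real.sqrt (sInv p q) / (energy p * energy q)

/-- The Lorentz factor `γ = (p⁰ + q⁰) / √s`. -/
def lorentzFactor (p q : Momentum) : ℝ := (energy p + energy q) / Real.sqrt (sInv p q)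

/-- The vector `ω + (γ - 1) (p + q) ((p + q) · ω) / |p + q|²`. For `p + q = 0` it is `ω`
(here Lean's `x / 0 = 0` agrees with the continuous extension). -/
def boostDir (p q : Momentum) (ω : Sphere2) : Momentum :=
  (ω : Momentum) +
    ((lorentzFactor p q - 1) * (inner ℝ (p + q) (ω : Momentum) / ‖p + q‖ ^ 2)) • (p + q)

/-- The momentum `p'`. -/
def postP (p q : Momentum) (ω : Sphere2) : Momentum :=
  (1 / 2 : ℝ) • (p + q) + (relMom p q / 2) • boostDir p q ω

/-- The momentum `q'`. -/
def postQ (p q : Momentum) (ω : Sphere2) : Momentum :=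
  (1 / 2 : ℝ) • (p + q) - (relMom p q / 2) • boostDir p q ω

/-- The scattering angle `θ ∈ [0, π]`, `cos θ = (p^μ - q^μ)(p'_μ - q'_μ) / g²`. -/
def scatAngle (p q : Momentum) (ω : Sphere2) : ℝ :=
  Real.arccos
    (lorentzInner (fourVec p - fourVec q) (fourVec (postP p q ω) - fourVec (postQ p q ω))
      / relMom p q ^ 2)

/-- The hypothesis on the scattering kernel: `σ(g, θ) ≈ g σ₀(θ)`, with comparison constants
`c₁`, `c₂`, where `0 ≤ σ₀ ≤ M`. (As `σ₀` is measurable and bounded, it is integrable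
on the sphere.) -/
structure HardSphereKernel (M c₁ c₂ : ℝ) (σ₀ : ℝ → ℝ) (σ : ℝ → ℝ → ℝ) : Prop where
  measurable_angular : Measurable σ₀
  measurable_kernel : Measurable (Function.uncurry σ)
  angular_nonneg : ∀ θ ∈ Set.Icc 0 Real.pi, 0 ≤ σ₀ θ
  angular_le : ∀ θ ∈ Set.Icc 0 Real.pi, σ₀ θ ≤ M
  lower : ∀ g > 0, ∀ θ ∈ Set.Icc 0 Real.pi, c₁ * (g * σ₀ θ) ≤ σ g θ
  upper : ∀ g > 0, ∀ θ ∈ Set.Icc 0 Real.pi, σ g θ ≤ c₂ * (g * σ₀ θ)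

/-- The integrand `v_M σ(g, θ) f(p') h(q')` of the gain term. -/
def gainIntegrand (σ : ℝ → ℝ → ℝ) (f h : Momentum → ℝ) (p q : Momentum) (ω : Sphere2) : ℝ :=
  mollerVel p q * σ (relMom p q) (scatAngle p q ω) * f (postP p q ω) * h (postQ p q ω)

/-- The gain term `Q⁺(f, h)(p) = ∫_{ℝ³} ∫_{𝕊²} v_M σ(g, θ) f(p') h(q') dω dq`. -/
def gain (σ : ℝ → ℝ → ℝ) (f h : Momentum → ℝ) (p : Momentum) : ℝ :=
  ∫ q, ∫ ω, gainIntegrand σ f h p q ω ∂sphereMeasure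

/-- `‖f(·, p)‖_{L^∞_{x₁}}`, the essential supremum of `|f(x₁, p)|` over `x₁ ∈ [0,1]`. -/
def supNormX (f : unitInterval → Momentum → ℝ) (p : Momentum) : ENNReal :=
  essSup (fun x => ENNReal.ofReal |f x p|) volume

/-- The weight `(p⁰)^{1/2} φ(p)` with `φ(p) = e^{k p⁰}`. -/
def weight (k : ℝ) (p : Momentum) : ENNReal :=
  ENNReal.ofReal (energy p ^ (1 / 2 : ℝ) * Real.exp (k * energy p))

/-- `‖f‖ = ∫ esssup_{x₁} |f(x₁, p)| (p⁰)^{1/2} φ(p) dp`, with values in `[0, ∞]`. -/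
def weightedNorm (k : ℝ) (f : unitInterval → Momentum → ℝ) : ENNReal :=
  ∫⁻ p, weight k p * supNormX f p

/-- The Lebesgue measure of a linear subspace `E` (the Haar measure of `E` giving mass one to
the parallelepiped of an orthonormal basis), viewed as a measure on momentum space. -/
def planeMeasure (E : Submodule ℝ Momentum) : Measure Momentum :=
  ((stdOrthonormalBasis ℝ E).toBasis.addHaar).map (fun v : E => (v : Momentum))

/-- The two-dimensional planes through the origin. -/
abbrev Plane : Type := {E : Submodule ℝ Momentum // Module.finrank ℝ E = 2}

end

end RelBoltzmann

open MeasureTheory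

namespace RelBoltzmann

noncomputable section

/-! ### Energy and the Lorentz invariants -/

/-! Put `F = supNormX f`. The kernel is at most `c₂ M g`, and energy conservation gives `φ(p) ≤
φ(p') φ(q')`. Everything thus reduces to a linear estimate: for nonnegative measurable `H` on pairs
of momenta, `∫_E ∫ ∫ (p⁰)^{1/2} v_M g H(p', q') dω dq dσ_E ≤ 96π ∫∫ (p⁰q⁰)^{1/2} H(p, q) dp dq`. For
`H` the tensor square of `φF`, the right side is `96π ‖f‖²` by Tonelli (`lintegral_plane_gain_le`,
`pairIntegral_weightedPair`).

To prove it, replace `E` by the slab `|n · p| < ε`, with `n` a unit normal. The pre-post collisional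
change of variables (`lintegral_post_swap`) moves the collision map from `H` to the slab indicator.
For fixed `p, q`, the number `n · p'` is an affine function of `ω` with gradient of length at least
`g/2`. By Archimedes' theorem on slabs of the sphere, the set of admissible `ω` has measure `O(ε/g)`
(`sphereMeasure_postP_slab_le`). The factor `g` of the hard-sphere kernel cancels `1/g`, and `v_M`
and `(p'⁰)^{1/2}` are controlled by `mollerVel_le` and `sqrt_energy_post_le`. The slab integral is
therefore at most its width `2ε` times the right side, uniformly in `E`.

Letting `ε → 0` requires lower semicontinuity in the distance from `E`. Fatou supplies it when `H`
is the indicator of an open set (`lintegral_le_of_forall_slab`). This compares two measures on open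
sets; outer regularity extends the comparison to all Borel sets (`planeGainMeasure_le`), hence to
every measurable `H`.

The change of variables rests on center-of-momentum coordinates `(P, k)`, in which `v_M dp dq`
becomes `8|k| / E dP dk`, with `E` the total energy. This density depends only on `P` and `|k|`, and
a collision merely replaces `k` by `|k|ω`, so in polar coordinates it is symmetric under exchanging
the two directions. -/

lemma energy_sq (p : Momentum) : energy p ^ 2 = 1 + ‖p‖ ^ 2 :=
  Real.sq_sqrt (by positivity)

lemma one_le_energy (p : Momentum) : 1 ≤ energy p :=
  Real.one_le_sqrt.2 (by nlinarith [sq_nonneg ‖p‖])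

lemma energy_pos (p : Momentum) : 0 < energy p := one_pos.trans_le (one_le_energy p)

/-- Cauchy–Schwarz for `(1, |p|)` and `(1, |q|)`. It makes the radicand of `relMom` nonnegative, so
squaring loses nothing. -/
lemma norm_mul_norm_le (p q : Momentum) : ‖p‖ * ‖q‖ ≤ energy p * energy q - 1 := by
  have h1 := energy_sq p
  have h2 := energy_sq q
  have h3 : (‖p‖ * ‖q‖ + 1) ^ 2 ≤ (energy p * energy q) ^ 2 := by
    rw [mul_pow, h1, h2]
    nlinarith [sq_nonneg (‖p‖ - ‖q‖)]
  have := abs_le_of_sq_le_sq' h3 (mul_pos (energy_pos p) (energy_pos q)).le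
  linarith [this.2]

lemma abs_inner_le (p q : Momentum) : |inner ℝ p q| ≤ energy p * energy q - 1 :=
  (abs_real_inner_le_norm p q).trans (norm_mul_norm_le p q)

lemma sInv_eq (p q : Momentum) :
    sInv p q = 2 + 2 * (energy p * energy q) - 2 * inner ℝ p q := by
  have h1 := energy_sq p
  have h2 := energy_sq q
  simp only [sInv, lorentzInner, fourVec, Prod.fst_add, Prod.snd_add, real_inner_self_eq_norm_sq,
    norm_add_sq_real]
  linarith

lemma relMom_arg_eq (p q : Momentum) :
    lorentzInner (fourVec p - fourVec q) (fourVec p - fourVec q) =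
      2 * (energy p * energy q) - 2 * inner ℝ p q - 2 := by
  have h1 := energy_sq p
  have h2 := energy_sq q
  simp only [lorentzInner, fourVec, Prod.fst_sub, Prod.snd_sub, real_inner_self_eq_norm_sq,
    norm_sub_sq_real]
  linarith

lemma relMom_nonneg (p q : Momentum) : 0 ≤ relMom p q := Real.sqrt_nonneg _

lemma relMom_sq (p q : Momentum) :
    relMom p q ^ 2 = 2 * (energy p * energy q) - 2 * inner ℝ p q - 2 := by
  rw [relMom, relMom_arg_eq, Real.sq_sqrt]
  linarith [le_of_abs_le (abs_inner_le p q)]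

lemma sInv_eq_relMom (p q : Momentum) : sInv p q = 4 + relMom p q ^ 2 := by
  rw [sInv_eq, relMom_sq]; ring

lemma sInv_eq_sub (p q : Momentum) :
    sInv p q = (energy p + energy q) ^ 2 - ‖p + q‖ ^ 2 := by
  rw [sInv_eq, norm_add_sq_real]
  linarith [energy_sq p, energy_sq q]

lemma sInv_le (p q : Momentum) : sInv p q ≤ 4 * (energy p * energy q) := by
  rw [sInv_eq]
  linarith [neg_le_of_abs_le (abs_inner_le p q)]

lemma mollerVel_nonneg (p q : Momentum) : 0 ≤ mollerVel p q := by
  have := energy_pos p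
  have := energy_pos q
  have := relMom_nonneg p q
  unfold mollerVel
  positivity

lemma mollerVel_le (p q : Momentum) : mollerVel p q ≤ 4 := by
  have h1 := mul_pos (energy_pos p) (energy_pos q)
  rw [mollerVel, div_le_iff₀ h1]
  have h2 := sInv_eq_relMom p q
  have h3 : 0 ≤ sInv p q := by rw [h2]; positivity
  have h4 : relMom p q ≤ √(sInv p q) := Real.le_sqrt_of_sq_le (by linarith)
  calc relMom p q * √(sInv p q) ≤ √(sInv p q) * √(sInv p q) := by gcongr
    _ = sInv p q := Real.mul_self_sqrt h3
    _ ≤ _ := sInv_le p q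

/-! ### Center-of-momentum coordinates

A pair `(p, q)` is described by its total momentum `P = p + q` and the relative momentum `k` in the
center-of-momentum frame. -/

/-- `√s` as a function of the center-of-momentum relative momentum. -/
def cmEnergy (k : Momentum) : ℝ := √(4 + 4 * ‖k‖ ^ 2)

/-- The total energy. -/
def totalEnergy (P k : Momentum) : ℝ := √(4 + 4 * ‖k‖ ^ 2 + ‖P‖ ^ 2)

/-- The coefficient `(γ - 1) / |P|²` of the Lorentz boost. -/
def boostCoeff (P k : Momentum) : ℝ :=
  (cmEnergy k * (totalEnergy P k + cmEnergy k))⁻¹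

/-- Half the difference `p - q` of the momenta. -/
def boost (P k : Momentum) : Momentum := k + (boostCoeff P k * inner ℝ P k) • P

/-- The first momentum of the pair with center-of-momentum coordinates `(P, k)`. -/
def cmFst (P k : Momentum) : Momentum := (1 / 2 : ℝ) • P + boost P k

/-- The second momentum of the pair with center-of-momentum coordinates `(P, k)`. -/
def cmSnd (P k : Momentum) : Momentum := (1 / 2 : ℝ) • P - boost P k

lemma cmEnergy_sq (k : Momentum) : cmEnergy k ^ 2 = 4 + 4 * ‖k‖ ^ 2 :=
  Real.sq_sqrt (by positivity)

lemma cmEnergy_pos (k : Momentum) : 0 < cmEnergy k := Real.sqrt_pos.2 (by positivity)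

lemma totalEnergy_sq (P k : Momentum) : totalEnergy P k ^ 2 = 4 + 4 * ‖k‖ ^ 2 + ‖P‖ ^ 2 :=
  Real.sq_sqrt (by positivity)

lemma totalEnergy_pos (P k : Momentum) : 0 < totalEnergy P k := Real.sqrt_pos.2 (by positivity)

lemma boostCoeff_pos (P k : Momentum) : 0 < boostCoeff P k := by
  have := cmEnergy_pos k
  have := totalEnergy_pos P k
  unfold boostCoeff
  positivity

/-- Since `|P|² = (E - S)(E + S)`, the form `1 / (S (E + S))` of the coefficient equals `(E/S - 1) /
|P|²` but stays regular at `P = 0`. -/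
lemma boostCoeff_mul_norm_sq (P k : Momentum) :
    1 + boostCoeff P k * ‖P‖ ^ 2 = totalEnergy P k / cmEnergy k := by
  have hS := cmEnergy_pos k
  have hE := totalEnergy_pos P k
  have h : ‖P‖ ^ 2 = totalEnergy P k ^ 2 - cmEnergy k ^ 2 := by
    rw [totalEnergy_sq, cmEnergy_sq]; ring
  rw [h, boostCoeff]
  field_simp
  ring

lemma boostCoeff_sq_add (P k : Momentum) :
    boostCoeff P k ^ 2 * ‖P‖ ^ 2 + 2 * boostCoeff P k = (cmEnergy k ^ 2)⁻¹ := by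
  have hS := cmEnergy_pos k
  have hE := totalEnergy_pos P k
  have h : ‖P‖ ^ 2 = totalEnergy P k ^ 2 - cmEnergy k ^ 2 := by
    rw [totalEnergy_sq, cmEnergy_sq]; ring
  rw [h, boostCoeff]
  field_simp
  ring

lemma inner_boost (P k : Momentum) :
    inner ℝ P (boost P k) = inner ℝ P k * (totalEnergy P k / cmEnergy k) := by
  rw [boost, inner_add_right, inner_smul_right, real_inner_self_eq_norm_sq,
    ← boostCoeff_mul_norm_sq]
  ring

lemma norm_boost_sq (P k : Momentum) :
    ‖boost P k‖ ^ 2 = ‖k‖ ^ 2 + (inner ℝ P k / cmEnergy k) ^ 2 := by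
  rw [boost, norm_add_sq_real, inner_smul_right, norm_smul, real_inner_comm k P, mul_pow,
    Real.norm_eq_abs, sq_abs, div_pow, div_eq_mul_inv _ (cmEnergy k ^ 2), ← boostCoeff_sq_add P k]
  ring

lemma cmEnergy_neg (k : Momentum) : cmEnergy (-k) = cmEnergy k := by simp [cmEnergy]

lemma totalEnergy_neg (P k : Momentum) : totalEnergy P (-k) = totalEnergy P k := by
  simp [totalEnergy]

lemma boost_neg (P k : Momentum) : boost P (-k) = -boost P k := by
  simp only [boost, boostCoeff, cmEnergy_neg, totalEnergy_neg, inner_neg_right]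
  module

lemma cmSnd_eq (P k : Momentum) : cmSnd P k = cmFst P (-k) := by
  rw [cmSnd, cmFst, boost_neg, sub_eq_add_neg]

lemma cmFst_add_cmSnd (P k : Momentum) : cmFst P k + cmSnd P k = P := by
  simp only [cmFst, cmSnd]; module

lemma abs_inner_div_cmEnergy_lt (P k : Momentum) :
    |inner ℝ P k / cmEnergy k| < totalEnergy P k / 2 := by
  have hS := cmEnergy_pos k
  have hE := totalEnergy_pos P k
  refine abs_lt_of_sq_lt_sq ?_ (by positivity)
  rw [div_pow, div_lt_iff₀ (by positivity), div_pow, totalEnergy_sq, cmEnergy_sq]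
  have h1 : (inner ℝ P k) ^ 2 ≤ (‖P‖ * ‖k‖) ^ 2 := by
    rw [← sq_abs]; gcongr; exact abs_real_inner_le_norm P k
  nlinarith [sq_nonneg ‖P‖, sq_nonneg ‖k‖, mul_nonneg (sq_nonneg ‖P‖) (sq_nonneg ‖k‖)]

lemma energy_cmFst (P k : Momentum) :
    energy (cmFst P k) = totalEnergy P k / 2 + inner ℝ P k / cmEnergy k := by
  have hS := cmEnergy_pos k
  -- This bound selects the positive root, once the squares are known to agree.
  have h := (abs_lt.1 (abs_inner_div_cmEnergy_lt P k)).1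
  rw [energy, Real.sqrt_eq_iff_mul_self_eq (by positivity) (by linarith), cmFst, norm_add_sq_real,
    norm_boost_sq, inner_smul_left, inner_boost, norm_smul, mul_pow]
  have := totalEnergy_sq P k
  simp only [map_div₀, map_one, map_ofNat, Real.norm_eq_abs, sq_abs]
  have e : totalEnergy P k * (inner ℝ P k / cmEnergy k) =
    inner ℝ P k * (totalEnergy P k / cmEnergy k) := by ring
  linear_combination e - this / 4

lemma energy_cmSnd (P k : Momentum) :
    energy (cmSnd P k) = totalEnergy P k / 2 - inner ℝ P k / cmEnergy k := by
  rw [cmSnd_eq, energy_cmFst, totalEnergy_neg, cmEnergy_neg, inner_neg_right]; ring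

lemma energy_cmFst_add_energy_cmSnd (P k : Momentum) :
    energy (cmFst P k) + energy (cmSnd P k) = totalEnergy P k := by
  rw [energy_cmFst, energy_cmSnd]; ring

lemma sInv_cm (P k : Momentum) : sInv (cmFst P k) (cmSnd P k) = cmEnergy k ^ 2 := by
  rw [sInv_eq_sub, energy_cmFst_add_energy_cmSnd, cmFst_add_cmSnd, totalEnergy_sq, cmEnergy_sq]
  ring

lemma relMom_cm (P k : Momentum) : relMom (cmFst P k) (cmSnd P k) = 2 * ‖k‖ := by
  have h := sInv_eq_relMom (cmFst P k) (cmSnd P k)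
  rw [sInv_cm, cmEnergy_sq] at h
  have := relMom_nonneg (cmFst P k) (cmSnd P k)
  rw [← sq_eq_sq₀ this (by positivity)]
  linarith

lemma mollerVel_cm (P k : Momentum) :
    mollerVel (cmFst P k) (cmSnd P k) =
      2 * ‖k‖ * cmEnergy k / (energy (cmFst P k) * energy (cmSnd P k)) := by
  rw [mollerVel, relMom_cm, sInv_cm, Real.sqrt_sq (cmEnergy_pos k).le]

/-! ### The collision map -/

/-- The boost coefficient sees `k` only through its norm, so any vector of length `g/2` may be used.
-/
lemma boostDir_eq (p q : Momentum) (ω : Sphere2) (k : Momentum) (hk : 2 * ‖k‖ = relMom p q) :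
    boostDir p q ω = (ω : Momentum) +
      (boostCoeff (p + q) k * inner ℝ (p + q) (ω : Momentum)) • (p + q) := by
  have hs : sInv p q = cmEnergy k ^ 2 := by
    rw [sInv_eq_relMom, cmEnergy_sq, ← hk]; ring
  have hE : energy p + energy q = totalEnergy (p + q) k := by
    have := energy_pos p
    have := energy_pos q
    rw [← sq_eq_sq₀ (by positivity) (totalEnergy_pos _ _).le, totalEnergy_sq, ← cmEnergy_sq, ← hs,
      sInv_eq_sub]
    ring
  have hγ : lorentzFactor p q - 1 = boostCoeff (p + q) k * ‖p + q‖ ^ 2 := by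
    rw [lorentzFactor, hs, hE, Real.sqrt_sq (cmEnergy_pos k).le, ← boostCoeff_mul_norm_sq]
    ring
  rw [boostDir, hγ]
  by_cases h : p + q = 0
  · simp [h]
  · have : ‖p + q‖ ≠ 0 := norm_ne_zero_iff.2 h
    congr 2
    field_simp

lemma smul_boostDir (p q : Momentum) (ω : Sphere2) :
    (relMom p q / 2) • boostDir p q ω = boost (p + q) ((relMom p q / 2) • (ω : Momentum)) := by
  have h := relMom_nonneg p q
  have hk : 2 * ‖(relMom p q / 2) • (ω : Momentum)‖ = relMom p q := by
    rw [norm_smul, Real.norm_of_nonneg (by positivity), norm_eq_of_mem_sphere]; ring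
  rw [boostDir_eq p q ω _ hk, boost, smul_add, smul_smul, inner_smul_right]
  congr 2
  ring

lemma postP_eq (p q : Momentum) (ω : Sphere2) :
    postP p q ω = cmFst (p + q) ((relMom p q / 2) • (ω : Momentum)) := by
  rw [postP, smul_boostDir, cmFst]

lemma postQ_eq (p q : Momentum) (ω : Sphere2) :
    postQ p q ω = cmSnd (p + q) ((relMom p q / 2) • (ω : Momentum)) := by
  rw [postQ, smul_boostDir, cmSnd]

lemma postP_cm (P k : Momentum) (ω : Sphere2) :
    postP (cmFst P k) (cmSnd P k) ω = cmFst P (‖k‖ • (ω : Momentum)) := by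
  rw [postP_eq, cmFst_add_cmSnd, relMom_cm, mul_div_cancel_left₀ _ two_ne_zero]

lemma postQ_cm (P k : Momentum) (ω : Sphere2) :
    postQ (cmFst P k) (cmSnd P k) ω = cmSnd P (‖k‖ • (ω : Momentum)) := by
  rw [postQ_eq, cmFst_add_cmSnd, relMom_cm, mul_div_cancel_left₀ _ two_ne_zero]

/-! ### The boost is a bijection -/

/-- The pair built from `boost P k` has relative momentum `2|k|`, so the image determines `|k|`,
hence both energies and the coefficient. Then `inner_boost` recovers `P · k`, and `k` follows. -/
lemma boost_injective (P : Momentum) : Function.Injective (boost P) := by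
  intro k l h
  have hn : ‖k‖ = ‖l‖ := by
    have h1 := relMom_cm P k
    have h2 := relMom_cm P l
    simp only [cmFst, cmSnd, h] at h1 h2
    linarith
  have hS : cmEnergy k = cmEnergy l := by simp only [cmEnergy, hn]
  have hE : totalEnergy P k = totalEnergy P l := by simp only [totalEnergy, hn]
  have hi := inner_boost P k
  rw [h, inner_boost, hS, hE] at hi
  have hi' := mul_right_cancel₀ (div_pos (totalEnergy_pos P l) (cmEnergy_pos l)).ne' hi
  have hβ : boostCoeff P k = boostCoeff P l := by rw [boostCoeff, boostCoeff, hS, hE]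
  rw [boost, boost, hβ, ← hi'] at h
  exact add_right_cancel h

lemma boost_surjective (P : Momentum) : Function.Surjective (boost P) := by
  intro y
  set p := (1 / 2 : ℝ) • P + y with hp
  set q := (1 / 2 : ℝ) • P - y with hq
  have hP : p + q = P := by rw [hp, hq]; module
  have hg := relMom_nonneg p q
  set E := energy p + energy q with hEdef
  have hE0 : 0 < E := add_pos (energy_pos p) (energy_pos q)
  have hs0 : 0 < sInv p q := by rw [sInv_eq_relMom]; positivity
  have hS0 : 0 < √(sInv p q) := Real.sqrt_pos.2 hs0
  set S := √(sInv p q) with hSdef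
  have hS2 : S ^ 2 = 4 + relMom p q ^ 2 := by rw [hSdef, Real.sq_sqrt hs0.le, sInv_eq_relMom]
  have hES : E ^ 2 = S ^ 2 + ‖P‖ ^ 2 := by
    rw [hSdef, Real.sq_sqrt hs0.le, sInv_eq_sub, hP]; ring
  -- The inverse Lorentz boost, with `E` and `S` computed from the pair `P/2 ± y` rather than from
  -- the unknown `k`.
  set k := y - (inner ℝ P y / (E * (E + S))) • P with hkdef
  have hnp : energy p ^ 2 = 1 + ‖P‖ ^ 2 / 4 + inner ℝ P y + ‖y‖ ^ 2 := by
    rw [energy_sq, hp, norm_add_sq_real, inner_smul_left, norm_smul, mul_pow]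
    simp; ring
  have hnq : energy q ^ 2 = 1 + ‖P‖ ^ 2 / 4 - inner ℝ P y + ‖y‖ ^ 2 := by
    rw [energy_sq, hq, norm_sub_sq_real, inner_smul_left, norm_smul, mul_pow]
    simp; ring
  -- Half the difference of the squared energies, factored.
  have hPy : inner ℝ P y = E * (energy p - energy q) / 2 := by
    rw [hEdef]; linear_combination (hnq - hnp) / 2
  have hg2 : relMom p q ^ 2 / 4 = ‖y‖ ^ 2 - (inner ℝ P y) ^ 2 / E ^ 2 := by
    have : (inner ℝ P y) ^ 2 / E ^ 2 = (energy p - energy q) ^ 2 / 4 := by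
      rw [hPy]; field_simp; norm_num
    rw [this]
    have h1 : relMom p q ^ 2 = E ^ 2 - ‖P‖ ^ 2 - 4 := by rw [hES, hS2]; ring
    rw [h1, hEdef]
    linear_combination (hnp + hnq) / 2
  have hk2 : ‖k‖ ^ 2 = relMom p q ^ 2 / 4 := by
    have hN : ‖P‖ ^ 2 = E ^ 2 - S ^ 2 := by rw [hES]; ring
    rw [hg2, hkdef, norm_sub_sq_real, inner_smul_right, norm_smul, mul_pow, real_inner_comm P y,
      Real.norm_eq_abs, sq_abs, hN]
    field_simp
    ring
  have hkn : ‖k‖ = relMom p q / 2 := by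
    rw [← sq_eq_sq₀ (norm_nonneg _) (by positivity), hk2]; ring
  have hcS : cmEnergy k = S := by
    rw [← sq_eq_sq₀ (cmEnergy_pos k).le hS0.le, cmEnergy_sq, hk2, hS2]; ring
  have hcE : totalEnergy P k = E := by
    rw [← sq_eq_sq₀ (totalEnergy_pos P k).le hE0.le, totalEnergy_sq, hk2, hES, hS2]; ring
  refine ⟨k, ?_⟩
  rw [boost, boostCoeff, hcS, hcE]
  have hin : inner ℝ P k = inner ℝ P y * (S / E) := by
    have hN : ‖P‖ ^ 2 = E ^ 2 - S ^ 2 := by rw [hES]; ring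
    rw [hkdef, inner_sub_right, inner_smul_right, real_inner_self_eq_norm_sq, hN]
    field_simp
    ring
  rw [hin]
  have : (S * (E + S))⁻¹ * (inner ℝ P y * (S / E)) = inner ℝ P y / (E * (E + S)) := by
    field_simp
  rw [this, hkdef, sub_add_cancel]

/-! ### The Jacobian of the boost -/

lemma hasFDerivAt_cmEnergy (k : Momentum) :
    HasFDerivAt cmEnergy ((4 / cmEnergy k) • innerSL ℝ k) k := by
  have h1 : HasFDerivAt (fun k : Momentum => 4 + 4 * ‖k‖ ^ 2) ((4 : ℝ) • (2 • innerSL ℝ k)) k :=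
    (((hasStrictFDerivAt_norm_sq k).hasFDerivAt).const_mul 4).const_add 4
  have h2 := h1.sqrt (by positivity)
  refine h2.congr_fderiv ?_
  ext v
  have hS := cmEnergy_pos k
  have e : √(4 + 4 * ‖k‖ ^ 2) = cmEnergy k := rfl
  simp only [e, smul_apply, innerSL_apply_apply, smul_eq_mul, nsmul_eq_mul]
  field_simp
  norm_num

lemma hasFDerivAt_totalEnergy (P k : Momentum) :
    HasFDerivAt (totalEnergy P) ((4 / totalEnergy P k) • innerSL ℝ k) k := by
  have h1 : HasFDerivAt (fun k : Momentum => 4 + 4 * ‖k‖ ^ 2 + ‖P‖ ^ 2)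
      ((4 : ℝ) • (2 • innerSL ℝ k)) k :=
    ((((hasStrictFDerivAt_norm_sq k).hasFDerivAt).const_mul 4).const_add 4).add_const _
  have h2 := h1.sqrt (by positivity)
  refine h2.congr_fderiv ?_
  ext v
  have hE := totalEnergy_pos P k
  have e : √(4 + 4 * ‖k‖ ^ 2 + ‖P‖ ^ 2) = totalEnergy P k := rfl
  simp only [e, smul_apply, innerSL_apply_apply, smul_eq_mul, nsmul_eq_mul]
  field_simp
  norm_num

lemma exists_hasFDerivAt_boostCoeff_mul_inner (P k : Momentum) :
    ∃ c : Momentum →L[ℝ] ℝ, HasFDerivAt (fun k => boostCoeff P k * inner ℝ P k) c k ∧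
      1 + c P = 4 * (energy (cmFst P k) * energy (cmSnd P k)) / (cmEnergy k * totalEnergy P k) := by
  have hS := cmEnergy_pos k
  have hE := totalEnergy_pos P k
  have h1 := (hasFDerivAt_cmEnergy k).mul
    ((hasFDerivAt_totalEnergy P k).add (hasFDerivAt_cmEnergy k))
  have h2 := (hasDerivAt_inv (mul_pos hS (add_pos hE hS)).ne').comp_hasFDerivAt k h1
  refine ⟨_, h2.mul (innerSL ℝ P).hasFDerivAt, ?_⟩
  have hN : ‖P‖ ^ 2 = totalEnergy P k ^ 2 - cmEnergy k ^ 2 := by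
    rw [totalEnergy_sq, cmEnergy_sq]; ring
  simp only [Function.comp_apply, Pi.add_apply, Pi.mul_apply, add_apply, smul_apply, innerSL_apply_apply,
    smul_eq_mul, real_inner_self_eq_norm_sq, real_inner_comm P k, energy_cmFst, energy_cmSnd, hN]
  field_simp
  ring

/-- The derivative is the identity plus the rank-one map `v ↦ c(v) P`, whose determinant is `1 +
c(P)`. -/
lemma exists_hasFDerivAt_boost (P k : Momentum) :
    ∃ T : Momentum →L[ℝ] Momentum, HasFDerivAt (boost P) T k ∧
      T.det = 4 * (energy (cmFst P k) * energy (cmSnd P k)) / (cmEnergy k * totalEnergy P k) := by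
  obtain ⟨c, hc, hval⟩ := exists_hasFDerivAt_boostCoeff_mul_inner P k
  refine ⟨_, (hasFDerivAt_id (𝕜 := ℝ) k).add (hc.smul_const P), ?_⟩
  rw [← hval]
  exact LinearMap.transvection.det (c : Momentum →ₗ[ℝ] ℝ) P

/-! ### Continuity -/

@[fun_prop]
lemma continuous_energy : Continuous energy := by
  unfold energy; fun_prop

lemma continuous_relMom : Continuous fun z : Momentum × Momentum => relMom z.1 z.2 := by
  unfold relMom lorentzInner fourVec
  fun_prop

lemma continuous_sInv : Continuous fun z : Momentum × Momentum => sInv z.1 z.2 := by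
  unfold sInv lorentzInner fourVec
  fun_prop

lemma continuous_mollerVel : Continuous fun z : Momentum × Momentum => mollerVel z.1 z.2 := by
  unfold mollerVel
  have h1 := continuous_relMom
  have h2 := continuous_sInv
  exact (h1.mul h2.sqrt).div (by fun_prop)
    fun z => (mul_pos (energy_pos z.1) (energy_pos z.2)).ne'

@[fun_prop]
lemma continuous_cmEnergy : Continuous cmEnergy := by
  unfold cmEnergy; fun_prop

lemma continuous_totalEnergy : Continuous fun z : Momentum × Momentum => totalEnergy z.1 z.2 := by
  unfold totalEnergy; fun_prop

lemma continuous_boost : Continuous fun z : Momentum × Momentum => boost z.1 z.2 := by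
  have hE := continuous_totalEnergy
  have : Continuous fun z : Momentum × Momentum => boostCoeff z.1 z.2 := by
    unfold boostCoeff
    refine Continuous.inv₀ (by fun_prop) fun z => ?_
    have := cmEnergy_pos z.2
    have := totalEnergy_pos z.1 z.2
    positivity
  unfold boost
  fun_prop

lemma continuous_cmPair :
    Continuous fun z : Momentum × Momentum => (cmFst z.1 z.2, cmSnd z.1 z.2) := by
  have := continuous_boost
  unfold cmFst cmSnd
  fun_prop

/-- The pair of momenta after a collision. -/
def post (z : Momentum × Momentum) (ω : Sphere2) : Momentum × Momentum :=
  (postP z.1 z.2 ω, postQ z.1 z.2 ω)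

lemma post_eq (z : Momentum × Momentum) (ω : Sphere2) :
    post z ω = (cmFst (z.1 + z.2) ((relMom z.1 z.2 / 2) • (ω : Momentum)),
      cmSnd (z.1 + z.2) ((relMom z.1 z.2 / 2) • (ω : Momentum))) := by
  rw [post, postP_eq, postQ_eq]

lemma continuous_post : Continuous fun z : (Momentum × Momentum) × Sphere2 => post z.1 z.2 := by
  simp only [post_eq]
  have h := continuous_relMom
  have h' : Continuous fun z : (Momentum × Momentum) × Sphere2 => relMom z.1.1 z.1.2 :=
    h.comp continuous_fst
  exact continuous_cmPair.comp (g := fun z : Momentum × Momentum => (cmFst z.1 z.2, cmSnd z.1 z.2))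
    (f := fun z : (Momentum × Momentum) × Sphere2 =>
      (z.1.1 + z.1.2, (relMom z.1.1 z.1.2 / 2) • (z.2 : Momentum))) (by fun_prop)

lemma post_cm (P k : Momentum) (ω : Sphere2) :
    post (cmFst P k, cmSnd P k) ω = (cmFst P (‖k‖ • (ω : Momentum)), cmSnd P (‖k‖ • (ω : Momentum))) := by
  rw [post, postP_cm, postQ_cm]

/-! ### Symmetry of the collision measure -/

instance : IsFiniteMeasure sphereMeasure := by
  unfold sphereMeasure; infer_instance

lemma lintegral_boost (P : Momentum) (Φ : Momentum → ENNReal) :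
    ∫⁻ y, Φ y = ∫⁻ k, ENNReal.ofReal (4 * (energy (cmFst P k) * energy (cmSnd P k)) /
      (cmEnergy k * totalEnergy P k)) * Φ (boost P k) := by
  choose T hT hdet using exists_hasFDerivAt_boost P
  have h := lintegral_image_eq_lintegral_abs_det_fderiv_mul volume MeasurableSet.univ
    (fun k _ => (hT k).hasFDerivWithinAt) (boost_injective P).injOn Φ
  rw [Set.image_univ, (boost_surjective P).range_eq, setLIntegral_univ, setLIntegral_univ] at h
  rw [h]
  refine lintegral_congr fun k => ?_
  rw [hdet, abs_of_nonneg]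
  have := cmEnergy_pos k
  have := totalEnergy_pos P k
  have := energy_pos (cmFst P k)
  have := energy_pos (cmSnd P k)
  positivity

lemma lintegral_lintegral_half_add_sub {Φ : Momentum → Momentum → ENNReal}
    (hΦ : Measurable (Function.uncurry Φ)) :
    ∫⁻ p, ∫⁻ q, Φ p q = ∫⁻ P : Momentum, ∫⁻ y, Φ ((1 / 2 : ℝ) • P + y) ((1 / 2 : ℝ) • P - y) := by
  calc ∫⁻ p, ∫⁻ q, Φ p q = ∫⁻ p, ∫⁻ P, Φ p (P - p) :=
        lintegral_congr fun p => (lintegral_sub_right_eq_self (fun q => Φ p q) p).symm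
    _ = ∫⁻ P, ∫⁻ p, Φ p (P - p) := lintegral_lintegral_swap
        (hΦ.comp (f := fun z : Momentum × Momentum => (z.1, z.2 - z.1)) (by fun_prop)).aemeasurable
    _ = _ := by
        refine lintegral_congr fun P => ?_
        rw [← lintegral_add_left_eq_self (fun p => Φ p (P - p)) ((1 / 2 : ℝ) • P)]
        refine lintegral_congr fun y => ?_
        congr 1
        module

/-- The factor `p⁰q⁰` of the Jacobian cancels the denominator of the Møller velocity, leaving a
density that depends only on `P` and `|k|`. -/
lemma lintegral_mollerVel_mul {Φ : Momentum × Momentum → ENNReal} (hΦ : Measurable Φ) :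
    ∫⁻ p, ∫⁻ q, ENNReal.ofReal (mollerVel p q) * Φ (p, q) =
      ∫⁻ P, ∫⁻ k, ENNReal.ofReal (8 * ‖k‖ / totalEnergy P k) * Φ (cmFst P k, cmSnd P k) := by
  have hm := continuous_mollerVel.measurable
  rw [lintegral_lintegral_half_add_sub (by unfold Function.uncurry; fun_prop)]
  refine lintegral_congr fun P => ?_
  rw [lintegral_boost P]
  refine lintegral_congr fun k => ?_
  change _ * (ENNReal.ofReal (mollerVel (cmFst P k) (cmSnd P k)) * Φ (cmFst P k, cmSnd P k)) = _
  have h1 := cmEnergy_pos k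
  have h2 := totalEnergy_pos P k
  have h3 := energy_pos (cmFst P k)
  have h4 := energy_pos (cmSnd P k)
  rw [← mul_assoc, ← ENNReal.ofReal_mul (by positivity), mollerVel_cm]
  congr 2
  field_simp
  ring

lemma lintegral_eq_lintegral_sphere (f : Momentum → ENNReal) :
    ∫⁻ k, f k = ∫⁻ z : Sphere2 × Set.Ioi (0 : ℝ), f ((z.2 : ℝ) • (z.1 : Momentum))
      ∂(sphereMeasure.prod (Measure.volumeIoiPow 2)) := by
  have h := (volume : Measure Momentum).measurePreserving_homeomorphUnitSphereProd
  have hd : Module.finrank ℝ Momentum - 1 = 2 := by simp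
  rw [hd] at h
  rw [sphereMeasure, ← h.lintegral_comp_emb (Homeomorph.measurableEmbedding _)]
  calc ∫⁻ k, f k = ∫⁻ k in {0}ᶜ, f k := by rw [restrict_compl_singleton]
    _ = ∫⁻ k : ({0}ᶜ : Set Momentum), f k ∂(Measure.comap Subtype.val volume) :=
        (lintegral_subtype_comap (measurableSet_singleton _).compl f).symm
    _ = _ := by
        refine lintegral_congr fun k => ?_
        have : ‖(k : Momentum)‖ ≠ 0 := norm_ne_zero_iff.2 k.2
        simp [smul_smul, this]

/-- In polar coordinates `k = rω₀`, both sides integrate over `r` and two directions; Tonelli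
exchanges `ω₀` and `ω`. -/
lemma lintegral_sphere_swap {Ψ : Momentum → Momentum → ENNReal}
    (hΨ : Measurable (Function.uncurry Ψ)) :
    ∫⁻ k, ∫⁻ ω, Ψ k (‖k‖ • (ω : Momentum)) ∂sphereMeasure =
      ∫⁻ k, ∫⁻ ω, Ψ (‖k‖ • (ω : Momentum)) k ∂sphereMeasure := by
  have key : ∀ Ψ : Momentum → Momentum → ENNReal, Measurable (Function.uncurry Ψ) →
      ∫⁻ k, ∫⁻ ω, Ψ k (‖k‖ • (ω : Momentum)) ∂sphereMeasure =
      ∫⁻ r : Set.Ioi (0 : ℝ), ∫⁻ ω₀ : Sphere2, ∫⁻ ω : Sphere2,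
        Ψ ((r : ℝ) • (ω₀ : Momentum)) ((r : ℝ) • (ω : Momentum))
        ∂sphereMeasure ∂sphereMeasure ∂(Measure.volumeIoiPow 2) := by
    intro Ψ hΨ
    rw [lintegral_eq_lintegral_sphere]
    have hn : ∀ z : Sphere2 × Set.Ioi (0 : ℝ), ‖((z.2 : ℝ) • (z.1 : Momentum))‖ = z.2 := by
      intro z
      rw [norm_smul, norm_eq_of_mem_sphere, mul_one, Real.norm_of_nonneg (le_of_lt z.2.2)]
    simp only [hn]
    rw [lintegral_prod_symm]
    refine (Measurable.lintegral_prod_right ?_).aemeasurable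
    exact hΨ.comp (f := fun z : (Sphere2 × Set.Ioi (0 : ℝ)) × Sphere2 =>
      (((z.1.2 : ℝ) • (z.1.1 : Momentum)), ((z.1.2 : ℝ) • (z.2 : Momentum)))) (by fun_prop)
  rw [key Ψ hΨ, key (fun a b => Ψ b a) (hΨ.comp measurable_swap)]
  refine lintegral_congr fun r => ?_
  refine lintegral_lintegral_swap (Measurable.aemeasurable ?_)
  exact hΨ.comp (f := fun z : Sphere2 × Sphere2 =>
      (((r : ℝ) • (z.1 : Momentum)), ((r : ℝ) • (z.2 : Momentum)))) (by fun_prop)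

lemma measurable_cmPair (P : Momentum) : Measurable fun k => (cmFst P k, cmSnd P k) :=
  (continuous_cmPair.comp (continuous_const.prodMk continuous_id :
    Continuous fun k : Momentum => (P, k))).measurable

lemma measurable_totalEnergy (P : Momentum) : Measurable (totalEnergy P) :=
  (continuous_totalEnergy.comp (continuous_const.prodMk continuous_id :
    Continuous fun k : Momentum => (P, k))).measurable

lemma norm_norm_smul_sphere (k : Momentum) (ω : Sphere2) : ‖‖k‖ • (ω : Momentum)‖ = ‖k‖ := by
  rw [norm_smul, norm_norm, norm_eq_of_mem_sphere, mul_one]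

lemma lintegral_cm_swap {Θ : Momentum × Momentum → Momentum × Momentum → ENNReal}
    (hΘ : Measurable (Function.uncurry Θ)) (P : Momentum) :
    ∫⁻ k, ENNReal.ofReal (8 * ‖k‖ / totalEnergy P k) *
      ∫⁻ ω, Θ (cmFst P k, cmSnd P k) (post (cmFst P k, cmSnd P k) ω) ∂sphereMeasure =
    ∫⁻ k, ENNReal.ofReal (8 * ‖k‖ / totalEnergy P k) *
      ∫⁻ ω, Θ (post (cmFst P k, cmSnd P k) ω) (cmFst P k, cmSnd P k) ∂sphereMeasure := by
  have hP := measurable_cmPair P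
  have hEP := measurable_totalEnergy P
  have hΨ : Measurable (Function.uncurry fun a b : Momentum =>
      ENNReal.ofReal (8 * ‖a‖ / totalEnergy P a) *
        Θ (cmFst P a, cmSnd P a) (cmFst P b, cmSnd P b)) := by
    refine Measurable.mul (by fun_prop) ?_
    exact hΘ.comp ((hP.comp measurable_fst).prodMk (hP.comp measurable_snd))
  have h := lintegral_sphere_swap hΨ
  have hT : ∀ (k : Momentum) (ω : Sphere2), totalEnergy P (‖k‖ • (ω : Momentum)) = totalEnergy P k :=
    fun k ω => by simp only [totalEnergy, norm_norm_smul_sphere]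
  simp only [norm_norm_smul_sphere, hT] at h
  simp only [← lintegral_const_mul' _ _ ENNReal.ofReal_ne_top, post_cm]
  exact h

/-- The pre-post collisional change of variables. -/
lemma lintegral_post_swap {Θ : Momentum × Momentum → Momentum × Momentum → ENNReal}
    (hΘ : Measurable (Function.uncurry Θ)) :
    ∫⁻ p, ∫⁻ q, ENNReal.ofReal (mollerVel p q) * ∫⁻ ω, Θ (p, q) (post (p, q) ω) ∂sphereMeasure =
    ∫⁻ p, ∫⁻ q, ENNReal.ofReal (mollerVel p q) *
      ∫⁻ ω, Θ (post (p, q) ω) (p, q) ∂sphereMeasure := by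
  have hpost := continuous_post.measurable
  rw [lintegral_mollerVel_mul (Φ := fun z => ∫⁻ ω, Θ z (post z ω) ∂sphereMeasure)
      (Measurable.lintegral_prod_right (hΘ.comp (measurable_fst.prodMk hpost))),
    lintegral_mollerVel_mul (Φ := fun z => ∫⁻ ω, Θ (post z ω) z ∂sphereMeasure)
      (Measurable.lintegral_prod_right (hΘ.comp (hpost.prodMk measurable_fst)))]
  exact lintegral_congr fun P => lintegral_cm_swap hΘ P

/-! ### Slabs on the sphere -/

lemma measurePreserving_piFinThree :
    MeasurePreserving (fun z : (ℝ × ℝ) × ℝ => (![z.1.1, z.1.2, z.2] : Fin 3 → ℝ)) := by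
  have h1 := (volume_preserving_piFinSuccAbove (fun _ : Fin 3 => ℝ) (Fin.last 2)).symm
  have h2 := (volume_preserving_finTwoArrow ℝ).symm
  have h3 : MeasurePreserving (Prod.swap : (ℝ × ℝ) × ℝ → ℝ × (ℝ × ℝ)) :=
    Measure.measurePreserving_swap
  have h4 := h1.comp (((MeasurePreserving.id (volume : Measure ℝ)).prod h2).comp h3)
  convert h4 using 1
  ext z i
  fin_cases i <;> rfl

/-- The point with coordinates `((x, y), t)` in an orthonormal basis. -/
def ofCoords (b : OrthonormalBasis (Fin 3) ℝ Momentum) (z : (ℝ × ℝ) × ℝ) : Momentum :=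
  z.1.1 • b 0 + z.1.2 • b 1 + z.2 • b 2

@[fun_prop]
lemma continuous_ofCoords (b : OrthonormalBasis (Fin 3) ℝ Momentum) : Continuous (ofCoords b) := by
  unfold ofCoords; fun_prop

lemma ofCoords_eq (b : OrthonormalBasis (Fin 3) ℝ Momentum) (z : (ℝ × ℝ) × ℝ) :
    ofCoords b z = b.repr.symm (WithLp.toLp 2 ![z.1.1, z.1.2, z.2]) := by
  rw [← b.sum_repr_symm, Fin.sum_univ_three]
  rfl

lemma measurePreserving_ofCoords (b : OrthonormalBasis (Fin 3) ℝ Momentum) :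
    MeasurePreserving (ofCoords b) := by
  have h := (b.measurePreserving_repr_symm.comp
    (PiLp.volume_preserving_toLp (Fin 3))).comp measurePreserving_piFinThree
  rw [show ofCoords b = _ from funext (ofCoords_eq b)]
  exact h

lemma inner_ofCoords (b : OrthonormalBasis (Fin 3) ℝ Momentum) (z : (ℝ × ℝ) × ℝ) :
    inner ℝ (b 2) (ofCoords b z) = z.2 := by
  have h0 : inner ℝ (b 2) (b 0) = 0 := b.inner_eq_zero (by decide)
  have h1 : inner ℝ (b 2) (b 1) = 0 := b.inner_eq_zero (by decide)
  have h2 : inner ℝ (b 2) (b 2) = (1 : ℝ) := b.inner_eq_one 2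
  simp only [ofCoords, inner_add_right, inner_smul_right, h0, h1, h2]
  ring

lemma norm_ofCoords (b : OrthonormalBasis (Fin 3) ℝ Momentum) (z : (ℝ × ℝ) × ℝ) :
    ‖ofCoords b z‖ = √(z.1.1 ^ 2 + z.1.2 ^ 2 + z.2 ^ 2) := by
  rw [ofCoords_eq, LinearIsometryEquiv.norm_map, EuclideanSpace.norm_eq, Fin.sum_univ_three]
  simp

lemma exists_orthonormalBasis_two (e : Momentum) (he : ‖e‖ = 1) :
    ∃ b : OrthonormalBasis (Fin 3) ℝ Momentum, b 2 = e := by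
  have hv : Orthonormal ℝ (({2} : Set (Fin 3)).domRestrict fun _ => e) := by
    refine ⟨fun _ => he, fun i j hij => absurd (Subsingleton.elim i j) hij⟩
  obtain ⟨b, hb⟩ := hv.exists_orthonormalBasis_extension_of_card_eq (by simp)
  exact ⟨b, hb 2 rfl⟩

/-- Archimedes' theorem: the substitution `u = cos θ` turns `sin θ dθ` into Lebesgue measure on
heights. -/
lemma lintegral_sin_indicator_le (a δ : ℝ) :
    ∫⁻ θ in Set.Ioo 0 Real.pi, ENNReal.ofReal |-Real.sin θ| *
      (Set.Ioo (a - δ) (a + δ)).indicator 1 (Real.cos θ) ≤ ENNReal.ofReal (2 * δ) := by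
  rw [← lintegral_image_eq_lintegral_abs_deriv_mul measurableSet_Ioo
    (fun θ _ => (Real.hasDerivAt_cos θ).hasDerivWithinAt)
    (Real.injOn_cos.mono Set.Ioo_subset_Icc_self)
    ((Set.Ioo (a - δ) (a + δ)).indicator 1)]
  refine (setLIntegral_le_lintegral _ _).trans ?_
  rw [lintegral_indicator_one measurableSet_Ioo, Real.volume_Ioo]
  apply le_of_eq
  congr 1
  ring

/-- The intersection of the unit ball with a neighborhood of a circular cone, in coordinates given
by the distance `ρ` from the axis and the height `t`. -/
def coneSet (a δ : ℝ) : Set (ℝ × ℝ) :=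
  {z | z.1 ^ 2 + z.2 ^ 2 < 1 ∧ |z.2 - a * √(z.1 ^ 2 + z.2 ^ 2)| < δ * √(z.1 ^ 2 + z.2 ^ 2)}

lemma measurableSet_coneSet (a δ : ℝ) : MeasurableSet (coneSet a δ) := by
  have h : Continuous fun z : ℝ × ℝ => √(z.1 ^ 2 + z.2 ^ 2) := by fun_prop
  exact (measurableSet_lt (f := fun z : ℝ × ℝ => z.1 ^ 2 + z.2 ^ 2) (by fun_prop)
    measurable_const).inter (measurableSet_lt (f := fun z : ℝ × ℝ => |z.2 - a * √(z.1 ^ 2 + z.2 ^ 2)|)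
    (Continuous.measurable (by fun_prop)) (h.measurable.const_mul δ))

/-- The variable is `(t, ρ)`, height first, so planar polar coordinates give `t = r cos θ`, `ρ = r
sin θ`. The polar angle is then the colatitude, and the cone condition becomes `|cos θ - a| < δ`. -/
lemma lintegral_coneSet_half_plane_le (a δ : ℝ) :
    ∫⁻ z : ℝ × ℝ, (Set.Ioi (0 : ℝ)).indicator (fun ρ => ENNReal.ofReal ρ *
      (coneSet a δ).indicator 1 (ρ, z.1)) z.2 ≤ ENNReal.ofReal (2 * δ) := by
  have hsq : ∀ r : ℝ, 0 < r → ∀ θ, √((r * Real.sin θ) ^ 2 + (r * Real.cos θ) ^ 2) = r := by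
    intro r hr θ
    rw [Real.sqrt_eq_iff_mul_self_eq (by positivity) hr.le]
    linear_combination r ^ 2 * Real.sin_sq_add_cos_sq θ
  rw [← lintegral_comp_polarCoord_symm, polarCoord_target, Measure.volume_eq_prod,
    ← Measure.prod_restrict]
  refine (lintegral_prod_le _).trans ?_
  calc _ ≤ ∫⁻ r in Set.Ioi (0 : ℝ), (Set.Iio (1 : ℝ)).indicator
        (fun _ => ENNReal.ofReal (2 * δ)) r := by
        refine setLIntegral_mono' measurableSet_Ioi fun r hr => ?_
        have hr0 : (0 : ℝ) < r := hr
        by_cases hr1 : r < 1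
        · rw [Set.indicator_of_mem (show r ∈ Set.Iio (1 : ℝ) from hr1)]
          refine le_trans ?_ (lintegral_sin_indicator_le a δ)
          rw [← lintegral_indicator measurableSet_Ioo, ← lintegral_indicator measurableSet_Ioo]
          refine lintegral_mono fun θ => ?_
          by_cases hθ : θ ∈ Set.Ioo (-Real.pi) Real.pi
          swap
          · rw [Set.indicator_of_notMem hθ]; exact zero_le
          rw [Set.indicator_of_mem hθ]
          simp only [polarCoord_symm_apply]
          by_cases hs : r * Real.sin θ ∈ Set.Ioi (0 : ℝ)
          swap
          · rw [Set.indicator_of_notMem hs, smul_zero]; exact zero_le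
          rw [Set.indicator_of_mem hs]
          have hs0 : 0 < Real.sin θ := (mul_pos_iff_of_pos_left hr0).1 hs
          have hθ0 : 0 < θ := by
            by_contra hneg
            exact absurd hs0 (not_lt.2 (Real.sin_nonpos_of_nonpos_of_neg_pi_le (not_lt.1 hneg) hθ.1.le))
          rw [Set.indicator_of_mem (show θ ∈ Set.Ioo 0 Real.pi from ⟨hθ0, hθ.2⟩), abs_neg,
            abs_of_pos hs0, smul_eq_mul, ← mul_assoc, ← ENNReal.ofReal_mul hr0.le]
          -- Bounding `r²` by `1` instead of integrating it loses a factor `3`, which is harmless.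
          refine mul_le_mul' (ENNReal.ofReal_le_ofReal ?_) ?_
          · have : r * (r * Real.sin θ) = (r * r) * Real.sin θ := by ring
            rw [this]
            exact mul_le_of_le_one_left hs0.le (by nlinarith)
          · by_cases hc : (r * Real.sin θ, r * Real.cos θ) ∈ coneSet a δ
            swap
            · rw [Set.indicator_of_notMem hc]; exact zero_le
            have hc2 := hc.2
            simp only [hsq r hr0 θ] at hc2
            rw [mul_comm a, ← mul_sub, abs_mul, abs_of_pos hr0, mul_comm δ,
              mul_lt_mul_iff_right₀ hr0, abs_lt] at hc2
            rw [Set.indicator_of_mem hc, Set.indicator_of_mem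
              (show Real.cos θ ∈ Set.Ioo (a - δ) (a + δ) from ⟨by linarith, by linarith⟩)]
            rfl
        · rw [Set.indicator_of_notMem (show r ∉ Set.Iio (1 : ℝ) from hr1), nonpos_iff_eq_zero]
          refine lintegral_eq_zero_of_ae_eq_zero (Filter.Eventually.of_forall fun θ => ?_)
          have hc : (r * Real.sin θ, r * Real.cos θ) ∉ coneSet a δ := by
            intro hc
            have h1 : (r * Real.sin θ) ^ 2 + (r * Real.cos θ) ^ 2 < 1 := hc.1
            have h2 : (r * Real.sin θ) ^ 2 + (r * Real.cos θ) ^ 2 = r ^ 2 := by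
              linear_combination r ^ 2 * Real.sin_sq_add_cos_sq θ
            nlinarith
          simp only [polarCoord_symm_apply]
          by_cases hs : r * Real.sin θ ∈ Set.Ioi (0 : ℝ)
          · rw [Set.indicator_of_mem hs, Set.indicator_of_notMem hc]; simp
          · rw [Set.indicator_of_notMem hs]; simp
    _ ≤ _ := by
        rw [lintegral_indicator measurableSet_Iio, Measure.restrict_restrict measurableSet_Iio,
          Set.inter_comm, Set.Ioi_inter_Iio, setLIntegral_const, Real.volume_Ioo]
        simp

lemma lintegral_radial_le (g : ℝ → ENNReal) (hg : Measurable g) :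
    ∫⁻ z : ℝ × ℝ, g (√(z.1 ^ 2 + z.2 ^ 2)) ≤
      ENNReal.ofReal (2 * Real.pi) * ∫⁻ r in Set.Ioi (0 : ℝ), ENNReal.ofReal r * g r := by
  rw [← lintegral_comp_polarCoord_symm, polarCoord_target, Measure.volume_eq_prod,
    ← Measure.prod_restrict]
  refine (lintegral_prod_le _).trans ?_
  rw [← lintegral_const_mul _ (by fun_prop)]
  refine setLIntegral_mono' measurableSet_Ioi fun r hr => ?_
  have hr0 : (0 : ℝ) < r := hr
  have hsq : ∀ θ : ℝ, √((r * Real.cos θ) ^ 2 + (r * Real.sin θ) ^ 2) = r := by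
    intro θ
    rw [Real.sqrt_eq_iff_mul_self_eq (by positivity) hr0.le]
    linear_combination r ^ 2 * Real.sin_sq_add_cos_sq θ
  simp only [polarCoord_symm_apply, hsq, smul_eq_mul, setLIntegral_const, Real.volume_Ioo]
  rw [mul_comm, sub_neg_eq_add, two_mul]

lemma volume_cone_le (a δ : ℝ) (b : OrthonormalBasis (Fin 3) ℝ Momentum) :
    volume {x : Momentum | ‖x‖ < 1 ∧ |inner ℝ (b 2) x - a * ‖x‖| < δ * ‖x‖} ≤
      ENNReal.ofReal (4 * Real.pi * δ) := by
  have hD : MeasurableSet {x : Momentum | ‖x‖ < 1 ∧ |inner ℝ (b 2) x - a * ‖x‖| < δ * ‖x‖} :=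
    (measurableSet_lt measurable_norm measurable_const).inter
      (measurableSet_lt (Continuous.measurable (by fun_prop)) (measurable_norm.const_mul δ))
  have hC := measurableSet_coneSet a δ
  have hind : Measurable ((coneSet a δ).indicator (1 : ℝ × ℝ → ENNReal)) :=
    measurable_one.indicator hC
  rw [← (measurePreserving_ofCoords b).measure_preimage hD.nullMeasurableSet,
    ← lintegral_indicator_one ((measurePreserving_ofCoords b).measurable hD)]
  calc _ = ∫⁻ z : (ℝ × ℝ) × ℝ,
        (coneSet a δ).indicator (1 : ℝ × ℝ → ENNReal) (√(z.1.1 ^ 2 + z.1.2 ^ 2), z.2) := by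
        refine lintegral_congr fun z => ?_
        refine Set.indicator_eq_indicator ?_ rfl
        have h0 : 0 ≤ z.1.1 ^ 2 + z.1.2 ^ 2 := by positivity
        simp only [Set.mem_preimage, Set.mem_ofPred_eq, coneSet, inner_ofCoords, norm_ofCoords,
          Real.sq_sqrt h0]
        rw [Real.sqrt_lt' one_pos, one_pow]
    _ ≤ ∫⁻ t : ℝ, ∫⁻ w : ℝ × ℝ,
        (coneSet a δ).indicator (1 : ℝ × ℝ → ENNReal) (√(w.1 ^ 2 + w.2 ^ 2), t) := by
        refine le_of_eq (lintegral_prod_symm _ (Measurable.aemeasurable ?_))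
        exact hind.comp (g := (coneSet a δ).indicator (1 : ℝ × ℝ → ENNReal))
          (f := fun z : (ℝ × ℝ) × ℝ => (√(z.1.1 ^ 2 + z.1.2 ^ 2), z.2))
          (Continuous.measurable (by fun_prop))
    _ ≤ ∫⁻ t : ℝ, ENNReal.ofReal (2 * Real.pi) * ∫⁻ r in Set.Ioi (0 : ℝ), ENNReal.ofReal r *
        (coneSet a δ).indicator (1 : ℝ × ℝ → ENNReal) (r, t) :=
        lintegral_mono fun t => lintegral_radial_le
          (fun r => (coneSet a δ).indicator (1 : ℝ × ℝ → ENNReal) (r, t))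
          (hind.comp (by fun_prop))
    _ = ENNReal.ofReal (2 * Real.pi) * ∫⁻ z : ℝ × ℝ, (Set.Ioi (0 : ℝ)).indicator
        (fun ρ => ENNReal.ofReal ρ * (coneSet a δ).indicator 1 (ρ, z.1)) z.2 := by
        rw [lintegral_const_mul' _ _ ENNReal.ofReal_ne_top, Measure.volume_eq_prod,
          lintegral_prod _ (Measurable.aemeasurable ?_)]
        · simp only [lintegral_indicator measurableSet_Ioi]
        · have : (fun z : ℝ × ℝ => (Set.Ioi (0 : ℝ)).indicator
              (fun ρ => ENNReal.ofReal ρ * (coneSet a δ).indicator 1 (ρ, z.1)) z.2) =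
              (Set.univ ×ˢ Set.Ioi (0 : ℝ)).indicator (fun z : ℝ × ℝ => ENNReal.ofReal z.2 *
                (coneSet a δ).indicator 1 (z.2, z.1)) := by
            ext z
            by_cases hz : z.2 ∈ Set.Ioi (0 : ℝ)
            · rw [Set.indicator_of_mem hz, Set.indicator_of_mem
                (show z ∈ Set.univ ×ˢ Set.Ioi (0 : ℝ) from ⟨trivial, hz⟩)]
            · rw [Set.indicator_of_notMem hz, Set.indicator_of_notMem
                (show z ∉ Set.univ ×ˢ Set.Ioi (0 : ℝ) from fun h => hz h.2)]
          rw [this]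
          refine Measurable.indicator ?_ (MeasurableSet.univ.prod measurableSet_Ioi)
          exact Measurable.mul (by fun_prop) (hind.comp (by fun_prop))
    _ ≤ ENNReal.ofReal (2 * Real.pi) * ENNReal.ofReal (2 * δ) :=
        mul_le_mul_right (lintegral_coneSet_half_plane_le a δ) _
    _ = _ := by
        rw [← ENNReal.ofReal_mul (by positivity)]
        congr 1; ring

/-- The measure of a slab on the unit sphere is bounded by a multiple of its width. -/
lemma sphereMeasure_slab_le (e : Momentum) (he : ‖e‖ = 1) (a δ : ℝ) :
    sphereMeasure {ω | |inner ℝ e (ω : Momentum) - a| < δ} ≤ ENNReal.ofReal (12 * Real.pi * δ) := by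
  obtain ⟨b, rfl⟩ := exists_orthonormalBasis_two e he
  have hm : MeasurableSet {ω : Sphere2 | |inner ℝ (b 2) (ω : Momentum) - a| < δ} :=
    measurableSet_lt (Continuous.measurable (by fun_prop)) measurable_const
  rw [sphereMeasure, Measure.toSphere_apply' _ hm]
  -- Surface measure is the dimension `3` times the volume of the cone over the set inside the unit
  -- ball.
  calc _ ≤ (3 : ENNReal) * ENNReal.ofReal (4 * Real.pi * δ) := by
        refine mul_le_mul' (by simp) (le_trans (measure_mono ?_) (volume_cone_le a δ b))
        rintro x ⟨r, hr, _, ⟨ω, hω, rfl⟩, rfl⟩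
        have hr0 : 0 < r := hr.1
        have hn : ‖r • (ω : Momentum)‖ = r := by
          rw [norm_smul, norm_eq_of_mem_sphere, mul_one, Real.norm_of_nonneg hr0.le]
        refine ⟨by simpa [hn] using hr.2, ?_⟩
        simp only [hn, inner_smul_right]
        rw [mul_comm a, ← mul_sub, abs_mul, abs_of_pos hr0, mul_comm]
        exact mul_lt_mul_of_pos_right hω hr0
    _ = _ := by
        rw [show (3 : ENNReal) = ENNReal.ofReal 3 by simp, ← ENNReal.ofReal_mul (by norm_num)]
        congr 1; ring

/-! ### Integrals over slabs of momentum space -/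

lemma exists_cm (p q : Momentum) : ∃ P k, cmFst P k = p ∧ cmSnd P k = q := by
  obtain ⟨k, hk⟩ := boost_surjective (p + q) ((1 / 2 : ℝ) • (p - q))
  refine ⟨p + q, k, ?_, ?_⟩
  · rw [cmFst, hk]; module
  · rw [cmSnd, hk]; module

lemma relMom_post (p q : Momentum) (ω : Sphere2) :
    relMom (post (p, q) ω).1 (post (p, q) ω).2 = relMom p q := by
  obtain ⟨P, k, rfl, rfl⟩ := exists_cm p q
  rw [post_cm, relMom_cm, relMom_cm, norm_norm_smul_sphere]

lemma energy_post_add (p q : Momentum) (ω : Sphere2) :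
    energy (post (p, q) ω).1 + energy (post (p, q) ω).2 = energy p + energy q := by
  obtain ⟨P, k, rfl, rfl⟩ := exists_cm p q
  rw [post_cm, energy_cmFst_add_energy_cmSnd, energy_cmFst_add_energy_cmSnd]
  simp only [totalEnergy, norm_norm_smul_sphere]

lemma sqrt_energy_post_le (p q : Momentum) (ω : Sphere2) :
    √(energy (post (p, q) ω).1) ≤ 2 * √(energy p * energy q) := by
  have h := energy_post_add p q ω
  have h2 := energy_pos (post (p, q) ω).2
  have hp := one_le_energy p
  have hq := one_le_energy q
  rw [Real.sqrt_le_left (by positivity), mul_pow, Real.sq_sqrt (by positivity)]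
  nlinarith

/-- The boost is symmetric, so `n · p' = A + (g/2) w · ω` with `w` the boosted normal. A boost does
not shorten vectors, so the slab in momentum space pulls back to a slab of half-width at most `2ε/g`
on the sphere. -/
lemma sphereMeasure_postP_slab_le (n : Momentum) (hn : ‖n‖ = 1) (p q : Momentum)
    (hg : 0 < relMom p q) {ε : ℝ} (hε : 0 < ε) :
    sphereMeasure {ω | |inner ℝ n (postP p q ω)| < ε} ≤
      ENNReal.ofReal (24 * Real.pi * ε / relMom p q) := by
  set g := relMom p q with hgdef
  have hk : 2 * ‖(g / 2) • n‖ = g := by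
    rw [norm_smul, hn, Real.norm_of_nonneg (by positivity)]; ring
  set β := boostCoeff (p + q) ((g / 2) • n) with hβdef
  have hβ : 0 < β := boostCoeff_pos _ _
  set w : Momentum := n + (β * inner ℝ n (p + q)) • (p + q) with hw
  have hw1 : 1 ≤ ‖w‖ := by
    have : 1 ≤ ‖w‖ ^ 2 := by
      rw [hw, norm_add_sq_real, hn, inner_smul_right]
      have : 0 ≤ 2 * (β * inner ℝ n (p + q) * inner ℝ n (p + q)) := by
        rw [mul_assoc]
        exact mul_nonneg zero_le_two (mul_nonneg hβ.le (mul_self_nonneg _))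
      nlinarith [sq_nonneg ‖(β * inner ℝ n (p + q)) • (p + q)‖]
    nlinarith [norm_nonneg w]
  have hw0 : 0 < ‖w‖ := one_pos.trans_le hw1
  set A := inner ℝ n ((1 / 2 : ℝ) • (p + q)) with hA
  have hpost : ∀ ω : Sphere2, inner ℝ n (postP p q ω) =
      (g / 2 * ‖w‖) * (inner ℝ (‖w‖⁻¹ • w) (ω : Momentum) - (-A / (g / 2 * ‖w‖))) := by
    intro ω
    have h1 : inner ℝ n (postP p q ω) = A + g / 2 * inner ℝ w (ω : Momentum) := by
      rw [postP, boostDir_eq p q ω _ hk, inner_add_right, ← hA, ← hgdef, ← hβdef, inner_smul_right,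
        inner_add_right, inner_smul_right, hw, inner_add_left n, inner_smul_left]
      simp only [conj_trivial]
      ring
    rw [h1, inner_smul_left]
    simp only [conj_trivial]
    field_simp
    ring
  have hgw : 0 < g / 2 * ‖w‖ := by positivity
  calc _ ≤ sphereMeasure {ω | |inner ℝ (‖w‖⁻¹ • w) (ω : Momentum) - (-A / (g / 2 * ‖w‖))|
          < 2 * ε / g} := by
        refine measure_mono fun ω hω => ?_
        rw [Set.mem_ofPred_eq, hpost, abs_mul, abs_of_pos hgw, ← lt_div_iff₀' hgw] at hω
        refine lt_of_lt_of_le hω ?_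
        rw [div_le_div_iff₀ hgw hg]
        nlinarith [mul_pos hε hg]
    _ ≤ _ := sphereMeasure_slab_le _ (by
        rw [norm_smul, norm_inv, norm_norm, inv_mul_cancel₀ hw0.ne']) _ _
    _ = _ := by congr 1; ring

/-- The density `(p⁰)^{1/2} v_M g`. -/
def gainDensity (z : Momentum × Momentum) : ENNReal :=
  ENNReal.ofReal (√(energy z.1) * mollerVel z.1 z.2 * relMom z.1 z.2)

lemma continuous_gainDensity : Continuous gainDensity := by
  have h1 := continuous_mollerVel
  have h2 := continuous_relMom
  unfold gainDensity
  exact ENNReal.continuous_ofReal.comp (by fun_prop)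

/-- The integral of `H` over pairs of momenta, with weight `(p⁰ q⁰)^{1/2}`. -/
def pairIntegral (H : Momentum × Momentum → ENNReal) : ENNReal :=
  ∫⁻ p, ∫⁻ q, ENNReal.ofReal √(energy p * energy q) * H (p, q)

lemma lintegral_slab_gain_le (n : Momentum) (hn : ‖n‖ = 1) {ε : ℝ} (hε : 0 < ε)
    {H : Momentum × Momentum → ENNReal} (hH : Measurable H) :
    ∫⁻ p in {p | |inner ℝ n p| < ε}, ∫⁻ q, ∫⁻ ω,
      gainDensity (p, q) * H (post (p, q) ω) ∂sphereMeasure ≤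
      ENNReal.ofReal (2 * ε) * (ENNReal.ofReal (96 * Real.pi) * pairIntegral H) := by
  have hS : MeasurableSet {p : Momentum | |inner ℝ n p| < ε} :=
    measurableSet_lt (Continuous.measurable (by fun_prop)) measurable_const
  have hSind : Measurable ({p : Momentum | |inner ℝ n p| < ε}.indicator (1 : Momentum → ENNReal)) :=
    measurable_one.indicator hS
  have hg := continuous_relMom.measurable
  set Θ : Momentum × Momentum → Momentum × Momentum → ENNReal := fun z z' =>
    {p : Momentum | |inner ℝ n p| < ε}.indicator (1 : Momentum → ENNReal) z.1 *
      ENNReal.ofReal (√(energy z.1) * relMom z.1 z.2) * H z' with hΘdef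
  have hΘ : Measurable (Function.uncurry Θ) := by
    have h1 : Measurable fun z : Momentum × Momentum =>
        {p : Momentum | |inner ℝ n p| < ε}.indicator (1 : Momentum → ENNReal) z.1 *
        ENNReal.ofReal (√(energy z.1) * relMom z.1 z.2) := by
      refine (hSind.comp measurable_fst).mul (ENNReal.measurable_ofReal.comp (Measurable.mul ?_ hg))
      exact Continuous.measurable (by fun_prop)
    exact (h1.comp measurable_fst).mul (hH.comp measurable_snd)
  calc _ = ∫⁻ p, ∫⁻ q, ENNReal.ofReal (mollerVel p q) *
        ∫⁻ ω, Θ (p, q) (post (p, q) ω) ∂sphereMeasure := by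
        rw [← lintegral_indicator hS]
        refine lintegral_congr fun p => ?_
        by_cases hp : p ∈ {p : Momentum | |inner ℝ n p| < ε}
        · rw [Set.indicator_of_mem hp]
          refine lintegral_congr fun q => ?_
          rw [← lintegral_const_mul' _ _ ENNReal.ofReal_ne_top]
          refine lintegral_congr fun ω => ?_
          simp only [hΘdef, Set.indicator_of_mem hp, Pi.one_apply, one_mul, ← mul_assoc]
          rw [← ENNReal.ofReal_mul (mollerVel_nonneg p q), gainDensity]
          congr 2
          ring
        · rw [Set.indicator_of_notMem hp]
          simp [hΘdef, Set.indicator_of_notMem hp]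
    -- The slab condition now falls on `p'`, where the integral over `ω` can exploit it.
    _ = ∫⁻ p, ∫⁻ q, ENNReal.ofReal (mollerVel p q) *
        ∫⁻ ω, Θ (post (p, q) ω) (p, q) ∂sphereMeasure := lintegral_post_swap hΘ
    _ ≤ ∫⁻ p, ∫⁻ q, (ENNReal.ofReal (2 * ε) * ENNReal.ofReal (96 * Real.pi)) *
        (ENNReal.ofReal √(energy p * energy q) * H (p, q)) := by
        refine lintegral_mono fun p => lintegral_mono fun q => ?_
        -- At `g = 0` the slab bound is unavailable, but the Møller velocity vanishes.
        rcases (relMom_nonneg p q).eq_or_lt with h0 | h0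
        · simp [mollerVel, ← h0]
        have hm := mollerVel_le p q
        calc _ ≤ ENNReal.ofReal 4 * ∫⁻ ω,
              {ω : Sphere2 | |inner ℝ n (postP p q ω)| < ε}.indicator (1 : Sphere2 → ENNReal) ω *
              (ENNReal.ofReal (2 * √(energy p * energy q) * relMom p q) * H (p, q))
                ∂sphereMeasure := by
              refine mul_le_mul' (ENNReal.ofReal_le_ofReal hm) (lintegral_mono fun ω => ?_)
              simp only [hΘdef, ← mul_assoc]
              refine mul_le_mul' (mul_le_mul' (le_of_eq ?_) (ENNReal.ofReal_le_ofReal ?_)) le_rfl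
              · exact Set.indicator_eq_indicator Iff.rfl rfl
              · rw [relMom_post]
                exact mul_le_mul_of_nonneg_right (sqrt_energy_post_le p q ω) h0.le
          _ = ENNReal.ofReal 4 * (sphereMeasure {ω : Sphere2 | |inner ℝ n (postP p q ω)| < ε} *
              (ENNReal.ofReal (2 * √(energy p * energy q) * relMom p q) * H (p, q))) := by
              have hpost : Measurable fun ω => postP p q ω := (continuous_fst.comp
                (continuous_post.comp (continuous_const.prodMk continuous_id :
                  Continuous fun ω : Sphere2 => ((p, q), ω)))).measurable
              have hms : MeasurableSet {ω : Sphere2 | |inner ℝ n (postP p q ω)| < ε} :=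
                hpost hS
              rw [lintegral_mul_const _ (measurable_one.indicator hms),
                lintegral_indicator_one hms]
          _ ≤ ENNReal.ofReal 4 * (ENNReal.ofReal (24 * Real.pi * ε / relMom p q) *
              (ENNReal.ofReal (2 * √(energy p * energy q) * relMom p q) * H (p, q))) := by
              gcongr
              exact sphereMeasure_postP_slab_le n hn p q h0 hε
          -- The constants combine to `4 · (24πε/g) · 2g = 2ε · 96π`.
          _ = _ := by
              simp only [← mul_assoc]
              congr 1
              have := Real.pi_pos
              rw [← ENNReal.ofReal_mul (by positivity), ← ENNReal.ofReal_mul (by positivity),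
                ← ENNReal.ofReal_mul (by positivity), ← ENNReal.ofReal_mul (by positivity)]
              congr 1
              field_simp
              ring
    _ = _ := by
        have hc : ENNReal.ofReal (2 * ε) * ENNReal.ofReal (96 * Real.pi) ≠ ⊤ :=
          ENNReal.mul_ne_top ENNReal.ofReal_ne_top ENNReal.ofReal_ne_top
        rw [← mul_assoc, pairIntegral, ← lintegral_const_mul' _ _ hc]
        exact lintegral_congr fun p => lintegral_const_mul' _ _ hc

/-! ### From slabs to planes -/

/-- By Fatou, `t ↦ ∫ D t` is lower semicontinuous at `0`. Any number below its value there is a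
lower bound near `0`, hence at most the averages over small intervals, which are at most `K`. -/
lemma lintegral_le_of_forall_slab {Y : Type*} [MeasurableSpace Y] {ν : Measure Y}
    {D : ℝ → Y → ENNReal} (hD : ∀ t, Measurable (D t))
    (hlsc : ∀ y, LowerSemicontinuousAt (fun t => D t y) 0) {K : ENNReal}
    (hK : ∀ ε > 0, ∫⁻ t in Set.Ioo (-ε) ε, ∫⁻ y, D t y ∂ν ≤ ENNReal.ofReal (2 * ε) * K) :
    ∫⁻ y, D 0 y ∂ν ≤ K := by
  refine le_of_forall_lt fun c hc => ?_
  have h1 : ∫⁻ y, D 0 y ∂ν ≤ Filter.liminf (fun t => ∫⁻ y, D t y ∂ν) (nhds 0) :=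
    (lintegral_mono fun y => lowerSemicontinuousAt_iff_le_liminf.1 (hlsc y)).trans
      (lintegral_liminf_le hD)
  obtain ⟨c', hcc', hc'⟩ := exists_between hc
  have h2 := Filter.eventually_lt_of_lt_liminf (hc'.trans_le h1)
  obtain ⟨ε, hε, hball⟩ := Metric.eventually_nhds_iff_ball.1 h2
  rw [Real.ball_eq_Ioo, zero_sub, zero_add] at hball
  have h3 : ENNReal.ofReal (2 * ε) * c' ≤ ENNReal.ofReal (2 * ε) * K := by
    refine le_trans ?_ (hK ε hε)
    calc _ = ∫⁻ _ in Set.Ioo (-ε) ε, c' := by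
          rw [setLIntegral_const, Real.volume_Ioo, mul_comm]; congr 2; ring
      _ ≤ _ := setLIntegral_mono' measurableSet_Ioo fun t ht => (hball t ht).le
  have h4 : ENNReal.ofReal (2 * ε) ≠ 0 := by simpa using hε
  exact hcc'.trans_le ((ENNReal.mul_le_mul_iff_right h4 ENNReal.ofReal_ne_top).1 h3)

lemma lowerSemicontinuousAt_mul_indicator {X Z : Type*} [TopologicalSpace X] [TopologicalSpace Z]
    {h : X → ENNReal} {γ : X → Z} (hh : Continuous h) (hγ : Continuous γ) {U : Set Z}
    (hU : IsOpen U) (x : X) :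
    LowerSemicontinuousAt (fun t => h t * U.indicator (1 : Z → ENNReal) (γ t)) x := by
  intro c hc
  by_cases hx : γ x ∈ U
  · simp only [Set.indicator_of_mem hx, Pi.one_apply, mul_one] at hc
    filter_upwards [hγ.continuousAt.preimage_mem_nhds (hU.mem_nhds hx),
      hh.continuousAt.eventually (lt_mem_nhds hc)] with t ht1 ht2
    rw [Set.indicator_of_mem (show γ t ∈ U from ht1), Pi.one_apply, mul_one]
    exact ht2
  · simp [Set.indicator_of_notMem hx] at hc

/-- An orthonormal basis of `E` is completed by a unit normal `b 2`; the third coordinate then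
parametrizes the planes parallel to `E`. -/
lemma exists_orthonormalBasis_planeMeasure (E : Plane) :
    ∃ b : OrthonormalBasis (Fin 3) ℝ Momentum,
      planeMeasure E.1 = Measure.map (fun w : ℝ × ℝ => ofCoords b (w, 0)) volume := by
  let c : OrthonormalBasis (Fin 2) ℝ E.1 := (stdOrthonormalBasis ℝ E.1).reindex (finCongr E.2)
  have hv : Orthonormal ℝ (({0, 1} : Set (Fin 3)).domRestrict
      fun i => if i = 0 then (c 0 : Momentum) else (c 1 : Momentum)) := by
    have h0 : ‖(c 0 : Momentum)‖ = 1 := c.norm_eq_one 0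
    have h1 : ‖(c 1 : Momentum)‖ = 1 := c.norm_eq_one 1
    have h01 : inner ℝ (c 0 : Momentum) (c 1 : Momentum) = 0 :=
      c.inner_eq_zero (by decide : (0 : Fin 2) ≠ 1)
    constructor
    · rintro ⟨i, rfl | rfl⟩ <;> simp [h0, h1]
    · rintro ⟨i, rfl | rfl⟩ ⟨j, rfl | rfl⟩ hij
      · exact absurd rfl hij
      · simpa using h01
      · simpa [real_inner_comm] using h01
      · exact absurd rfl hij
  obtain ⟨b, hb⟩ := hv.exists_orthonormalBasis_extension_of_card_eq (by simp)
  have hb0 : b 0 = c 0 := by simpa using hb 0 (by simp)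
  have hb1 : b 1 = c 1 := by simpa using hb 1 (by simp)
  refine ⟨b, ?_⟩
  have h := (c.measurePreserving_repr_symm.comp
    (PiLp.volume_preserving_toLp (Fin 2))).comp (volume_preserving_finTwoArrow ℝ).symm
  rw [planeMeasure, OrthonormalBasis.addHaar_eq_volume, ← h.map_eq,
    Measure.map_map measurable_subtype_coe h.measurable]
  congr 1
  funext w
  simp only [Function.comp_apply, ← c.sum_repr_symm, Fin.sum_univ_two, ofCoords, hb0, hb1]
  simp

lemma measurable_post_prod :
    Measurable fun z : Momentum × (Momentum × Sphere2) => post (z.1, z.2.1) z.2.2 :=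
  (continuous_post.comp (g := fun z : (Momentum × Momentum) × Sphere2 => post z.1 z.2)
    (f := fun z : Momentum × (Momentum × Sphere2) => ((z.1, z.2.1), z.2.2))
    (by fun_prop)).measurable

lemma measurable_gainDensity_mul {H : Momentum × Momentum → ENNReal} (hH : Measurable H) :
    Measurable fun z : Momentum × (Momentum × Sphere2) =>
      gainDensity (z.1, z.2.1) * H (post (z.1, z.2.1) z.2.2) :=
  (continuous_gainDensity.measurable.comp (by fun_prop)).mul (hH.comp measurable_post_prod)

lemma lintegral_plane_gain_le_of_isOpen (E : Plane) {U : Set (Momentum × Momentum)}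
    (hU : IsOpen U) :
    ∫⁻ p, ∫⁻ q, ∫⁻ ω, gainDensity (p, q) * U.indicator 1 (post (p, q) ω) ∂sphereMeasure
      ∂volume ∂(planeMeasure E.1) ≤ ENNReal.ofReal (96 * Real.pi) * pairIntegral (U.indicator 1) := by
  obtain ⟨b, hb⟩ := exists_orthonormalBasis_planeMeasure E
  have hH : Measurable (U.indicator (1 : Momentum × Momentum → ENNReal)) :=
    measurable_one.indicator hU.measurableSet
  have hm := measurable_gainDensity_mul hH
  have hprod : ∀ p : Momentum, ∫⁻ q, ∫⁻ ω, gainDensity (p, q) * U.indicator 1 (post (p, q) ω)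
      ∂sphereMeasure = ∫⁻ y : Momentum × Sphere2, gainDensity (p, y.1) *
        U.indicator 1 (post (p, y.1) y.2) ∂(volume.prod sphereMeasure) := fun p =>
    (lintegral_prod _ (hm.comp measurable_prodMk_left).aemeasurable).symm
  have hmI : Measurable fun p : Momentum => ∫⁻ y : Momentum × Sphere2, gainDensity (p, y.1) *
        U.indicator 1 (post (p, y.1) y.2) ∂(volume.prod sphereMeasure) := hm.lintegral_prod_right
  simp only [hprod]
  rw [hb, lintegral_map hmI (Continuous.measurable (by fun_prop))]
  have hmc : ∀ t : ℝ, Measurable fun x : (ℝ × ℝ) × (Momentum × Sphere2) =>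
      gainDensity (ofCoords b (x.1, t), x.2.1) *
        U.indicator 1 (post (ofCoords b (x.1, t), x.2.1) x.2.2) := fun t =>
    hm.comp (f := fun x : (ℝ × ℝ) × (Momentum × Sphere2) => (ofCoords b (x.1, t), x.2))
      (Continuous.measurable (by fun_prop))
  -- With `t` fixed, all other variables are gathered in one product space, so that Fatou applies
  -- once.
  have hI : ∀ t : ℝ, ∫⁻ w : ℝ × ℝ, ∫⁻ y : Momentum × Sphere2, gainDensity (ofCoords b (w, t), y.1) *
        U.indicator 1 (post (ofCoords b (w, t), y.1) y.2) ∂(volume.prod sphereMeasure) =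
      ∫⁻ x : (ℝ × ℝ) × (Momentum × Sphere2), gainDensity (ofCoords b (x.1, t), x.2.1) *
        U.indicator 1 (post (ofCoords b (x.1, t), x.2.1) x.2.2)
        ∂(volume.prod (volume.prod sphereMeasure)) := fun t =>
    (lintegral_prod _ (hmc t).aemeasurable).symm
  rw [hI]
  refine lintegral_le_of_forall_slab (D := fun t (x : (ℝ × ℝ) × (Momentum × Sphere2)) =>
    gainDensity (ofCoords b (x.1, t), x.2.1) *
        U.indicator 1 (post (ofCoords b (x.1, t), x.2.1) x.2.2)) hmc (fun x => ?_) fun ε hε => ?_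
  · refine lowerSemicontinuousAt_mul_indicator (continuous_gainDensity.comp (by fun_prop)) ?_ hU 0
    exact continuous_post.comp (g := fun z : (Momentum × Momentum) × Sphere2 => post z.1 z.2)
      (f := fun t : ℝ => ((ofCoords b (x.1, t), x.2.1), x.2.2)) (by fun_prop)
  · refine le_trans (le_of_eq ?_) (lintegral_slab_gain_le (b 2) (b.norm_eq_one 2) hε hH)
    simp only [← hI, hprod]
    have hS : MeasurableSet {p : Momentum | |inner ℝ (b 2) p| < ε} :=
      measurableSet_lt (Continuous.measurable (by fun_prop)) measurable_const
    rw [← lintegral_indicator hS, ← (measurePreserving_ofCoords b).lintegral_comp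
      (hmI.indicator hS), ← lintegral_indicator measurableSet_Ioo]
    refine Eq.trans ?_ (lintegral_prod_symm _ (Measurable.aemeasurable
      ((hmI.indicator hS).comp (measurePreserving_ofCoords b).measurable))).symm
    refine lintegral_congr fun t => ?_
    by_cases ht : t ∈ Set.Ioo (-ε) ε
    · rw [Set.indicator_of_mem ht]
      refine lintegral_congr fun w => ?_
      have hmem : ofCoords b (w, t) ∈ {p : Momentum | |inner ℝ (b 2) p| < ε} := by
        rw [Set.mem_ofPred_eq, inner_ofCoords]
        exact abs_lt.2 ht
      exact (Set.indicator_of_mem hmem (fun p => ∫⁻ y : Momentum × Sphere2,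
        gainDensity (p, y.1) * U.indicator 1 (post (p, y.1) y.2) ∂(volume.prod sphereMeasure))).symm
    · rw [Set.indicator_of_notMem ht]
      symm
      refine lintegral_eq_zero_of_ae_eq_zero (Filter.Eventually.of_forall fun w => ?_)
      have hnot : ofCoords b (w, t) ∉ {p : Momentum | |inner ℝ (b 2) p| < ε} := by
        rw [Set.mem_ofPred_eq, inner_ofCoords]
        exact fun h => ht (abs_lt.1 h)
      exact Set.indicator_of_notMem hnot (fun p => ∫⁻ y : Momentum × Sphere2,
        gainDensity (p, y.1) * U.indicator 1 (post (p, y.1) y.2) ∂(volume.prod sphereMeasure))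

/-! ### The bilinear estimate on planes -/

instance (E : Submodule ℝ Momentum) : SFinite (planeMeasure E) := by
  unfold planeMeasure; infer_instance

lemma measurable_post (p : Momentum) :
    Measurable fun z : Momentum × Sphere2 => post (p, z.1) z.2 :=
  (continuous_post.comp (g := fun z : (Momentum × Momentum) × Sphere2 => post z.1 z.2)
    (f := fun z : Momentum × Sphere2 => ((p, z.1), z.2)) (by fun_prop)).measurable

/-- The pushforward of the density `(p⁰)^{1/2} v_M g` on `E × ℝ³ × 𝕊²` under the collision map. -/
def planeGainMeasure (E : Plane) : Measure (Momentum × Momentum) :=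
  (((planeMeasure E.1).prod (volume.prod sphereMeasure)).withDensity
    fun z => gainDensity (z.1, z.2.1)).map fun z => post (z.1, z.2.1) z.2.2

/-- The measure `96 π (p⁰ q⁰)^{1/2} dp dq`. -/
def pairMeasure : Measure (Momentum × Momentum) :=
  (volume.prod volume).withDensity
    fun z => ENNReal.ofReal (96 * Real.pi * √(energy z.1 * energy z.2))

lemma lintegral_planeGainMeasure (E : Plane) {H : Momentum × Momentum → ENNReal}
    (hH : Measurable H) :
    ∫⁻ z, H z ∂(planeGainMeasure E) =
      ∫⁻ p, ∫⁻ q, ∫⁻ ω, gainDensity (p, q) * H (post (p, q) ω) ∂sphereMeasure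
        ∂volume ∂(planeMeasure E.1) := by
  have hm := measurable_gainDensity_mul hH
  have hd : Measurable fun z : Momentum × (Momentum × Sphere2) => gainDensity (z.1, z.2.1) :=
    continuous_gainDensity.measurable.comp (by fun_prop)
  rw [planeGainMeasure, lintegral_map hH measurable_post_prod,
    lintegral_withDensity_eq_lintegral_mul₀ hd.aemeasurable
      (g := fun z => H (post (z.1, z.2.1) z.2.2)) (hH.comp measurable_post_prod).aemeasurable]
  refine (lintegral_prod _ hm.aemeasurable).trans (lintegral_congr fun p => ?_)
  exact lintegral_prod _ (hm.comp measurable_prodMk_left).aemeasurable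

lemma lintegral_pairMeasure {H : Momentum × Momentum → ENNReal} (hH : Measurable H) :
    ∫⁻ z, H z ∂pairMeasure = ENNReal.ofReal (96 * Real.pi) * pairIntegral H := by
  have hd : Measurable fun z : Momentum × Momentum =>
      ENNReal.ofReal (96 * Real.pi * √(energy z.1 * energy z.2)) :=
    (ENNReal.continuous_ofReal.comp (by fun_prop)).measurable
  rw [pairMeasure, lintegral_withDensity_eq_lintegral_mul _ hd hH]
  refine (lintegral_prod _ (hd.mul hH).aemeasurable).trans ?_
  rw [pairIntegral, ← lintegral_const_mul' _ _ ENNReal.ofReal_ne_top]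
  refine lintegral_congr fun p => ?_
  rw [← lintegral_const_mul' _ _ ENNReal.ofReal_ne_top]
  refine lintegral_congr fun q => ?_
  have := Real.pi_pos
  rw [Pi.mul_apply, ENNReal.ofReal_mul (by positivity), mul_assoc]

instance : IsLocallyFiniteMeasure pairMeasure := by
  refine IsLocallyFiniteMeasure.withDensity_ofReal ?_
  fun_prop

/-- The open-set estimate passes to Borel sets by outer regularity of `pairMeasure`, which is
locally finite because its density is continuous. No regularity of the left-hand measure is needed.
-/
lemma planeGainMeasure_le (E : Plane) : planeGainMeasure E ≤ pairMeasure := by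
  refine Measure.le_iff.2 fun s _ => ?_
  rw [s.measure_eq_iInf_isOpen pairMeasure]
  refine le_iInf₂ fun U hsU => le_iInf fun hU => ?_
  refine (measure_mono hsU).trans ?_
  have hH : Measurable (U.indicator (1 : Momentum × Momentum → ENNReal)) :=
    measurable_one.indicator hU.measurableSet
  rw [← lintegral_indicator_one hU.measurableSet, ← lintegral_indicator_one hU.measurableSet,
    lintegral_planeGainMeasure E hH, lintegral_pairMeasure hH]
  exact lintegral_plane_gain_le_of_isOpen E hU

lemma lintegral_plane_gain_le (E : Plane) {H : Momentum × Momentum → ENNReal} (hH : Measurable H) :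
    ∫⁻ p, ∫⁻ q, ∫⁻ ω, gainDensity (p, q) * H (post (p, q) ω) ∂sphereMeasure
      ∂volume ∂(planeMeasure E.1) ≤ ENNReal.ofReal (96 * Real.pi) * pairIntegral H := by
  rw [← lintegral_planeGainMeasure E hH, ← lintegral_pairMeasure hH]
  exact lintegral_mono' (planeGainMeasure_le E) le_rfl

/-! ### The essential supremum in `x₁` -/

lemma measurable_supNormX {f : unitInterval → Momentum → ℝ} (hf : Measurable (Function.uncurry f)) :
    Measurable (supNormX f) := by
  have hm : Measurable fun z : Momentum × unitInterval => ENNReal.ofReal |f z.2 z.1| :=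
    ENNReal.measurable_ofReal.comp (hf.comp measurable_swap).abs
  refine measurable_of_Iic fun a => ?_
  -- A sublevel set of the essential supremum is where the measure of a section vanishes, and that
  -- measure depends measurably on `p`.
  have : supNormX f ⁻¹' Set.Iic a =
      {p | volume {x : unitInterval | a < ENNReal.ofReal |f x p|} = 0} := by
    ext p
    simp only [Set.mem_preimage, Set.mem_Iic, Set.mem_ofPred_eq, supNormX]
    have h0 : volume {x : unitInterval | a < ENNReal.ofReal |f x p|} = 0 ↔
        ∀ᵐ x : unitInterval, ENNReal.ofReal |f x p| ≤ a := by
      simp only [ae_iff, not_le]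
    rw [h0]
    refine ⟨fun h => ?_, fun h => essSup_le_of_ae_le a h⟩
    filter_upwards [ENNReal.ae_le_essSup fun x : unitInterval => ENNReal.ofReal |f x p|] with x hx
    exact hx.trans h
  rw [this]
  have hs : MeasurableSet {z : Momentum × unitInterval | a < ENNReal.ofReal |f z.2 z.1|} :=
    measurableSet_lt measurable_const hm
  exact (measurable_measure_prodMk_left hs) (measurableSet_singleton 0)

/-- The exceptional null set of `x` depends on the momentum; Fubini exchanges the quantifiers, so
that almost every `x` serves almost all post-collisional momenta. -/
lemma ae_ae_le_supNormX {Z : Type*} [MeasurableSpace Z] {μ : Measure Z} [SFinite μ]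
    {f : unitInterval → Momentum → ℝ} (hf : Measurable (Function.uncurry f))
    {g : Z → Momentum} (hg : Measurable g) :
    ∀ᵐ x : unitInterval, ∀ᵐ z ∂μ, ENNReal.ofReal |f x (g z)| ≤ supNormX f (g z) := by
  have hF := measurable_supNormX hf
  refine (Measure.ae_ae_comm ?_).2 (Filter.Eventually.of_forall fun z => ENNReal.ae_le_essSup _)
  refine measurableSet_le (ENNReal.measurable_ofReal.comp (Measurable.abs ?_))
    (hF.comp (hg.comp measurable_snd))
  exact hf.comp (measurable_fst.prodMk (hg.comp measurable_snd))

/-! ### Bounds on the gain term -/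

lemma measurable_scatAngle (p : Momentum) :
    Measurable fun z : Momentum × Sphere2 => scatAngle p z.1 z.2 := by
  have hpost := measurable_post p
  have hP : Measurable fun z : Momentum × Sphere2 => postP p z.1 z.2 := hpost.fst
  have hQ : Measurable fun z : Momentum × Sphere2 => postQ p z.1 z.2 := hpost.snd
  have hg : Measurable fun z : Momentum × Sphere2 => relMom p z.1 :=
    continuous_relMom.measurable.comp (f := fun z : Momentum × Sphere2 => (p, z.1)) (by fun_prop)
  have he := continuous_energy.measurable
  unfold scatAngle lorentzInner fourVec
  refine Real.measurable_arccos.comp (Measurable.div ?_ (hg.pow_const 2))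
  refine Measurable.add (Measurable.neg (Measurable.mul ?_ ?_)) (Measurable.inner ?_ ?_)
  · exact measurable_const.sub (he.comp measurable_fst)
  · exact (he.comp hP).sub (he.comp hQ)
  · exact measurable_const.sub measurable_fst
  · exact hP.sub hQ

lemma measurable_gainIntegrand {σ : ℝ → ℝ → ℝ} (hσ : Measurable (Function.uncurry σ))
    {f h : Momentum → ℝ} (hf : Measurable f) (hh : Measurable h) (p : Momentum) :
    Measurable fun z : Momentum × Sphere2 => gainIntegrand σ f h p z.1 z.2 := by
  have hpost := measurable_post p
  have hpair : Measurable fun z : Momentum × Sphere2 => (p, z.1) := by fun_prop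
  exact (((continuous_mollerVel.measurable.comp hpair).mul (hσ.comp
    ((continuous_relMom.measurable.comp hpair).prodMk (measurable_scatAngle p)))).mul
    (hf.comp hpost.fst)).mul (hh.comp hpost.snd)

lemma enorm_gainIntegrand_le {M c₁ c₂ : ℝ} (hc₁ : 0 < c₁) (hc₂ : 0 < c₂) {σ₀ : ℝ → ℝ}
    {σ : ℝ → ℝ → ℝ} (hσ : HardSphereKernel M c₁ c₂ σ₀ σ) (f h : Momentum → ℝ)
    (p q : Momentum) (ω : Sphere2) :
    ‖gainIntegrand σ f h p q ω‖ₑ ≤ ENNReal.ofReal (c₂ * M * (mollerVel p q * relMom p q)) *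
      (ENNReal.ofReal |f (post (p, q) ω).1| * ENNReal.ofReal |h (post (p, q) ω).2|) := by
  have hθ : scatAngle p q ω ∈ Set.Icc 0 Real.pi := ⟨Real.arccos_nonneg _, Real.arccos_le_pi _⟩
  have hσ0 := hσ.angular_nonneg _ hθ
  have hmv := mollerVel_nonneg p q
  have key : |mollerVel p q * σ (relMom p q) (scatAngle p q ω)| ≤
      c₂ * M * (mollerVel p q * relMom p q) := by
    -- The kernel bounds are assumed only for `g > 0`; at `g = 0` the factor `v_M` is zero.
    rcases (relMom_nonneg p q).eq_or_lt with h0 | h0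
    · simp [mollerVel, ← h0]
    have h1 : 0 ≤ σ (relMom p q) (scatAngle p q ω) :=
      (by positivity : 0 ≤ c₁ * (relMom p q * σ₀ (scatAngle p q ω))).trans (hσ.lower _ h0 _ hθ)
    have h2 : σ (relMom p q) (scatAngle p q ω) ≤ c₂ * (relMom p q * M) :=
      (hσ.upper _ h0 _ hθ).trans (by gcongr; exact hσ.angular_le _ hθ)
    rw [abs_of_nonneg (mul_nonneg hmv h1)]
    calc _ ≤ mollerVel p q * (c₂ * (relMom p q * M)) := by gcongr
      _ = _ := by ring
  rw [gainIntegrand, Real.enorm_eq_ofReal_abs, abs_mul, abs_mul, ENNReal.ofReal_mul (by positivity),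
    ENNReal.ofReal_mul (abs_nonneg _), mul_assoc]
  exact mul_le_mul' (ENNReal.ofReal_le_ofReal key) le_rfl

/-- The gain term of `F` with the kernel replaced by its upper bound. -/
def gainMajorant (C : ℝ) (F : Momentum → ENNReal) (p : Momentum) : ENNReal :=
  ∫⁻ q, ∫⁻ ω, ENNReal.ofReal (C * (mollerVel p q * relMom p q)) *
    (F (post (p, q) ω).1 * F (post (p, q) ω).2) ∂sphereMeasure

lemma ae_lintegral_gainIntegrand_le {M c₁ c₂ : ℝ} (hc₁ : 0 < c₁) (hc₂ : 0 < c₂)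
    {σ₀ : ℝ → ℝ} {σ : ℝ → ℝ → ℝ} (hσ : HardSphereKernel M c₁ c₂ σ₀ σ)
    {f : unitInterval → Momentum → ℝ} (hf : Measurable (Function.uncurry f)) (p : Momentum) :
    ∀ᵐ x : unitInterval, ∫⁻ z : Momentum × Sphere2, ‖gainIntegrand σ (f x) (f x) p z.1 z.2‖ₑ
      ∂(volume.prod sphereMeasure) ≤ gainMajorant (c₂ * M) (supNormX f) p := by
  have hpost := measurable_post p
  have hF := measurable_supNormX hf
  have hpair : Measurable fun z : Momentum × Sphere2 => (p, z.1) := by fun_prop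
  have hm : Measurable fun z : Momentum × Sphere2 =>
      ENNReal.ofReal (c₂ * M * (mollerVel p z.1 * relMom p z.1)) *
      (supNormX f (post (p, z.1) z.2).1 * supNormX f (post (p, z.1) z.2).2) :=
    (ENNReal.measurable_ofReal.comp (((continuous_mollerVel.measurable.comp hpair).mul
      (continuous_relMom.measurable.comp hpair)).const_mul (c₂ * M))).mul
      ((hF.comp hpost.fst).mul (hF.comp hpost.snd))
  filter_upwards [ae_ae_le_supNormX (μ := volume.prod sphereMeasure) hf hpost.fst,
    ae_ae_le_supNormX (μ := volume.prod sphereMeasure) hf hpost.snd] with x h1 h2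
  rw [gainMajorant, ← lintegral_prod _ hm.aemeasurable]
  refine lintegral_mono_ae ?_
  filter_upwards [h1, h2] with z hz1 hz2
  exact (enorm_gainIntegrand_le hc₁ hc₂ hσ _ _ _ _ _).trans
    (mul_le_mul' le_rfl (mul_le_mul' hz1 hz2))

lemma supNormX_gain_le {M c₁ c₂ : ℝ} (hc₁ : 0 < c₁) (hc₂ : 0 < c₂)
    {σ₀ : ℝ → ℝ} {σ : ℝ → ℝ → ℝ} (hσ : HardSphereKernel M c₁ c₂ σ₀ σ)
    {f : unitInterval → Momentum → ℝ} (hf : Measurable (Function.uncurry f)) (p : Momentum) :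
    supNormX (fun x => gain σ (f x) (f x)) p ≤ gainMajorant (c₂ * M) (supNormX f) p := by
  refine essSup_le_of_ae_le _ ?_
  filter_upwards [ae_lintegral_gainIntegrand_le hc₁ hc₂ hσ hf p] with x hx
  refine le_trans ?_ hx
  have hfx : Measurable (f x) := hf.comp measurable_prodMk_left
  have hm := measurable_gainIntegrand hσ.measurable_kernel hfx hfx p
  rw [lintegral_prod _ hm.enorm.aemeasurable, ← Real.enorm_eq_ofReal_abs, gain]
  exact (enorm_integral_le_lintegral_enorm _).trans
    (lintegral_mono fun q => enorm_integral_le_lintegral_enorm _)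

/-! ### The weights -/

/-- The function `(p, q) ↦ φ(p) F(p) φ(q) F(q)`. -/
def weightedPair (k : ℝ) (F : Momentum → ENNReal) (z : Momentum × Momentum) : ENNReal :=
  (ENNReal.ofReal (Real.exp (k * energy z.1)) * F z.1) *
    (ENNReal.ofReal (Real.exp (k * energy z.2)) * F z.2)

lemma measurable_weightedPair (k : ℝ) {F : Momentum → ENNReal} (hF : Measurable F) :
    Measurable (weightedPair k F) := by
  have h : Measurable fun p : Momentum => ENNReal.ofReal (Real.exp (k * energy p)) :=
    (ENNReal.continuous_ofReal.comp (by fun_prop)).measurable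
  exact ((h.comp measurable_fst).mul (hF.comp measurable_fst)).mul
    ((h.comp measurable_snd).mul (hF.comp measurable_snd))

lemma weight_eq (k : ℝ) (p : Momentum) :
    weight k p = ENNReal.ofReal √(energy p) * ENNReal.ofReal (Real.exp (k * energy p)) := by
  rw [weight, ← Real.sqrt_eq_rpow, ENNReal.ofReal_mul (Real.sqrt_nonneg _)]

lemma one_le_weight {k : ℝ} (hk : 0 < k) (p : Momentum) : 1 ≤ weight k p := by
  have h := energy_pos p
  rw [weight_eq]
  exact one_le_mul (ENNReal.one_le_ofReal.2 (Real.one_le_sqrt.2 (one_le_energy p)))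
    (ENNReal.one_le_ofReal.2 (Real.one_le_exp (by positivity)))

lemma measurable_weight (k : ℝ) : Measurable (weight k) := by
  unfold weight
  exact ENNReal.measurable_ofReal.comp
    ((continuous_energy.measurable.pow_const _).mul (Continuous.measurable (by fun_prop)))

lemma pairIntegral_weightedPair (k : ℝ) {F : Momentum → ENNReal} (hF : Measurable F) :
    pairIntegral (weightedPair k F) = (∫⁻ p, weight k p * F p) ^ 2 := by
  have hm : Measurable fun p => weight k p * F p := (measurable_weight k).mul hF
  rw [sq, ← lintegral_mul_const _ hm, pairIntegral]
  refine lintegral_congr fun p => ?_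
  rw [← lintegral_const_mul _ hm]
  refine lintegral_congr fun q => ?_
  rw [weightedPair, weight_eq, weight_eq, Real.sqrt_mul (energy_pos p).le,
    ENNReal.ofReal_mul (Real.sqrt_nonneg _)]
  ring

/-- Energy conservation and `e^{k q⁰} ≥ 1` give `φ(p) ≤ φ(p') φ(q')`, so only `(p⁰)^{1/2}` stays
with the pre-collisional momentum. -/
lemma weight_mul_gainMajorant_le {C k : ℝ} (hC : 0 ≤ C) (hk : 0 < k) (F : Momentum → ENNReal)
    (p : Momentum) :
    weight k p * gainMajorant C F p ≤ ENNReal.ofReal C *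
      ∫⁻ q, ∫⁻ ω, gainDensity (p, q) * weightedPair k F (post (p, q) ω) ∂sphereMeasure := by
  have hw : weight k p ≠ ⊤ := ENNReal.ofReal_ne_top
  rw [gainMajorant, ← lintegral_const_mul' _ _ hw, ← lintegral_const_mul' _ _ ENNReal.ofReal_ne_top]
  refine lintegral_mono fun q => ?_
  rw [← lintegral_const_mul' _ _ hw, ← lintegral_const_mul' _ _ ENNReal.ofReal_ne_top]
  refine lintegral_mono fun ω => ?_
  have he : ENNReal.ofReal (Real.exp (k * energy p)) ≤
      ENNReal.ofReal (Real.exp (k * energy (post (p, q) ω).1)) *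
        ENNReal.ofReal (Real.exp (k * energy (post (p, q) ω).2)) := by
    rw [← ENNReal.ofReal_mul (Real.exp_nonneg _), ← Real.exp_add, ← mul_add, energy_post_add]
    have := energy_pos q
    gcongr
    linarith
  have hmv := mollerVel_nonneg p q
  have hg := relMom_nonneg p q
  rw [weight_eq, ENNReal.ofReal_mul hC, gainDensity, weightedPair, mul_assoc √(energy p),
    ENNReal.ofReal_mul (Real.sqrt_nonneg _)]
  calc _ = ENNReal.ofReal (Real.exp (k * energy p)) * (ENNReal.ofReal C *
        (ENNReal.ofReal √(energy p) * ENNReal.ofReal (mollerVel p q * relMom p q) *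
        (F (post (p, q) ω).1 * F (post (p, q) ω).2))) := by ring
    _ ≤ _ := mul_le_mul' he le_rfl
    _ = _ := by ring

end

end RelBoltzmann

open RelBoltzmann MeasureTheory in
theorem proposition6p1 (M c₁ c₂ : ℝ) (hM : 0 < M) (hc₁ : 0 < c₁) (hc₂ : 0 < c₂) :
    ∃ C : ℝ, 0 < C ∧
      ∀ (σ₀ : ℝ → ℝ) (σ : ℝ → ℝ → ℝ), HardSphereKernel M c₁ c₂ σ₀ σ →
      ∀ k : ℝ, 0 < k →
      ∀ f : unitInterval → Momentum → ℝ, Measurable (Function.uncurry f) →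
        weightedNorm k f < ⊤ →
        (∀ E : Plane, ∀ᵐ p ∂(planeMeasure E.1), ∀ᵐ x : unitInterval,
          Integrable (fun z : Momentum × Sphere2 => gainIntegrand σ (f x) (f x) p z.1 z.2)
            (volume.prod sphereMeasure)) ∧
        (⨆ E : Plane, ∫⁻ p, weight k p * supNormX (fun x => gain σ (f x) (f x)) p
            ∂(planeMeasure E.1))
          ≤ ENNReal.ofReal C * weightedNorm k f ^ 2 := by
  have hcM : 0 < c₂ * M := mul_pos hc₂ hM
  refine ⟨c₂ * M * (96 * Real.pi), mul_pos hcM (by positivity), ?_⟩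
  intro σ₀ σ hσ k hk f hf hfin
  have hF := measurable_supNormX hf
  have hH := measurable_weightedPair k hF
  set B : Momentum → ENNReal := fun p => ∫⁻ q, ∫⁻ ω,
    gainDensity (p, q) * weightedPair k (supNormX f) (post (p, q) ω) ∂sphereMeasure with hB
  have hBm : Measurable B := by
    have h1 : Measurable fun z : Momentum × Momentum => ∫⁻ ω,
        gainDensity z * weightedPair k (supNormX f) (post z ω) ∂sphereMeasure :=
      Measurable.lintegral_prod_right ((continuous_gainDensity.measurable.comp measurable_fst).mul
        (hH.comp continuous_post.measurable))
    exact Measurable.lintegral_prod_right h1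
  have hBE : ∀ E : Plane, ∫⁻ p, B p ∂(planeMeasure E.1) ≤
      ENNReal.ofReal (96 * Real.pi) * weightedNorm k f ^ 2 := by
    intro E
    rw [weightedNorm, ← pairIntegral_weightedPair k hF]
    exact lintegral_plane_gain_le E hH
  constructor
  · intro E
    have hBfin : ∀ᵐ p ∂(planeMeasure E.1), B p < ⊤ := ae_lt_top hBm
      ((hBE E).trans_lt (ENNReal.mul_lt_top ENNReal.ofReal_lt_top (ENNReal.pow_lt_top hfin))).ne
    filter_upwards [hBfin] with p hp
    -- The weight is at least `1`, so finiteness of the weighted bound gives that of the majorant,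
    -- and with it absolute convergence.
    have hmaj : gainMajorant (c₂ * M) (supNormX f) p < ⊤ :=
      calc _ ≤ weight k p * gainMajorant (c₂ * M) (supNormX f) p :=
            le_mul_of_one_le_left' (one_le_weight hk p)
        _ ≤ _ := weight_mul_gainMajorant_le hcM.le hk _ p
        _ < ⊤ := ENNReal.mul_lt_top ENNReal.ofReal_lt_top hp
    filter_upwards [ae_lintegral_gainIntegrand_le hc₁ hc₂ hσ hf p] with x hx
    have hfx : Measurable (f x) := hf.comp measurable_prodMk_left
    exact ⟨(measurable_gainIntegrand hσ.measurable_kernel hfx hfx p).aestronglyMeasurable,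
      hx.trans_lt hmaj⟩
  · refine iSup_le fun E => ?_
    calc _ ≤ ∫⁻ p, ENNReal.ofReal (c₂ * M) * B p ∂(planeMeasure E.1) :=
          lintegral_mono fun p => (mul_le_mul' le_rfl (supNormX_gain_le hc₁ hc₂ hσ hf p)).trans
            (weight_mul_gainMajorant_le hcM.le hk _ p)
      _ = ENNReal.ofReal (c₂ * M) * ∫⁻ p, B p ∂(planeMeasure E.1) :=
          lintegral_const_mul' _ _ ENNReal.ofReal_ne_top
      _ ≤ ENNReal.ofReal (c₂ * M) *
          (ENNReal.ofReal (96 * Real.pi) * weightedNorm k f ^ 2) := mul_le_mul' le_rfl (hBE E)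
      _ = _ := by rw [← mul_assoc, ← ENNReal.ofReal_mul hcM.le]
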